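/- Let $k_0,k_1,u_0,u_1,q\in\mathbb C^*$, fix a square root $q^{1/2}$ of $q$, and let $H=H(\underline t;q)$, $\underline t=(k_0,k_1,u_0,u_1)$, be the double affine Hecke algebra of type $C^\vee C_1$: the unital associative $\mathbb C$-algebra with generators $T_0,T_1,T_0^\vee,T_1^\vee$ and relations $$(T_0-k_0)(T_0+k_0^{-1})=0,\quad (T_1-k_1)(T_1+k_1^{-1})=0,\quad (T_0^\vee-u_0)(T_0^\vee+u_0^{-1})=0,\quad (T_1^\vee-u_1)(T_1^\vee+u_1^{-1})=0,$$ $$T_1^\vee T_1T_0T_0^\vee=q^{-1/2}.$$ Suppose that $q$ is not a root of unity, and let $\rho:H\to \mathrm{Mat}_n(\mathbb C)$ be a finite-dimensional irreducible representation. Then $\rho$ is rigid, i.e. it admits no deformations (with $\underline t,q^{1/2}$ fixed), in each of the following senses. 1. Every formal deformation is trivial: if $\tilde\rho:H\to \mathrm{Mat}_n(\mathbb C[[x]])$ is a $\mathbb C$-algebra homomorphism with $\tilde\rho|_{x=0}=\rho$, then $\tilde\rho=g\rho g^{-1}$ for some $g\in GL_n(\mathbb C[[x]])$ with $g|_{x=0}=1$.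 2. The isomorphism class of $\rho$ is isolated: every representation $\rho':H\to \mathrm{Mat}_n(\mathbb C)$ whose values on the four generators are sufficiently close to those of $\rho$ is isomorphic to $\rho$. 3. Every first-order deformation $\tilde\rho:H\to \mathrm{Mat}_n(\mathbb C[\varepsilon]/(\varepsilon^2))$ of $\rho$ that is conjugacy-class preserving at each generator $T$ whose parameter $t$ satisfies $t^2=-1$ (that is, $\tilde\rho(T)=g_T\,\rho(T)\,g_T^{-1}$ with $g_T\in GL_n(\mathbb C[\varepsilon]/(\varepsilon^2))$, $g_T|_{\varepsilon=0}=1$) is trivial, i.e. $\tilde\rho=g\rho g^{-1}$ for some $g\in GL_n(\mathbb C[\varepsilon]/(\varepsilon^2))$ with $g|_{\varepsilon=0}=1$. Moreover, with $d_1,d_2,d_3,d_4$ the dimensions of $\mathrm{Ker}(\rho(T_0)-k_0)$, $\mathrm{Ker}(\rho(T_1)-k_1)$, $\mathrm{Ker}(\rho(T_0^\vee)-u_0)$, $\mathrm{Ker}(\rho(T_1^\vee)-u_1)$, one has $$2\Bigl(1-n^2+\sum_{i=1}^4 d_i(n-d_i)\Bigr)=0 .$$ -/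

import Mathlib

open scoped Topology

noncomputable section

/-- Labels of the four generators `T₀`, `T₁`, `T₀^∨`, `T₁^∨`. -/
inductive DAHAGen where
  | T0 | T1 | T0v | T1v
  deriving DecidableEq

instance : Fintype DAHAGen where
  elems := {DAHAGen.T0, DAHAGen.T1, DAHAGen.T0v, DAHAGen.T1v}
  complete := by intro x; cases x <;> decide

/-- The defining relations of the double affine Hecke algebra of type `C^∨C₁`, with parameters
`t = (k₀, k₁, u₀, u₁)`, the entry `t i` belonging to the generator with label `i`, and with
`s = q^{1/2}` the chosen square root of `q`. -/
inductive DAHARel (t : DAHAGen → ℂ) (s : ℂ) :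
    FreeAlgebra ℂ DAHAGen → FreeAlgebra ℂ DAHAGen → Prop
  | quadratic (i : DAHAGen) :
      DAHARel t s
        ((FreeAlgebra.ι ℂ i - algebraMap ℂ _ (t i)) *
          (FreeAlgebra.ι ℂ i + algebraMap ℂ _ (t i)⁻¹)) 0
  | product :
      DAHARel t s
        (FreeAlgebra.ι ℂ DAHAGen.T1v * FreeAlgebra.ι ℂ DAHAGen.T1 *
          FreeAlgebra.ι ℂ DAHAGen.T0 * FreeAlgebra.ι ℂ DAHAGen.T0v)
        (algebraMap ℂ _ s⁻¹)

/-- The double affine Hecke algebra `H(k₀, k₁, u₀, u₁; q)` of type `C^∨C₁`, `q = s ^ 2`. -/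
abbrev DAHA (t : DAHAGen → ℂ) (s : ℂ) : Type := RingQuot (DAHARel t s)

namespace DAHA

variable {t : DAHAGen → ℂ} {s : ℂ} {n : ℕ}

/-- The generator of `H` with label `i`. -/
def gen (t : DAHAGen → ℂ) (s : ℂ) (i : DAHAGen) : DAHA t s :=
  RingQuot.mkAlgHom ℂ (DAHARel t s) (FreeAlgebra.ι ℂ i)

/-- An `n`-dimensional representation of `H` over a commutative `ℂ`-algebra `R`,
written in a basis. -/
abbrev Rep (t : DAHAGen → ℂ) (s : ℂ) (n : ℕ) (R : Type) [CommRing R] [Algebra ℂ R] : Type :=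
  DAHA t s →ₐ[ℂ] Matrix (Fin n) (Fin n) R

/-- Irreducibility: the space `ℂⁿ` is nonzero and has no invariant subspaces except `0` and
itself. -/
def IsIrreducible (ρ : Rep t s n ℂ) : Prop :=
  0 < n ∧ ∀ W : Submodule ℂ (Fin n → ℂ),
    (∀ h : DAHA t s, ∀ w ∈ W, (ρ h).mulVec w ∈ W) → W = ⊥ ∨ W = ⊤

/-- Isomorphism of representations of the same dimension. -/
def Equivalent (ρ' ρ : Rep t s n ℂ) : Prop :=
  ∃ g : GL (Fin n) ℂ, ∀ h : DAHA t s,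
    ρ' h = (g : Matrix (Fin n) (Fin n) ℂ) * ρ h * ((g⁻¹ : GL (Fin n) ℂ) : Matrix _ _ ℂ)

section Deformations

variable {R : Type} [CommRing R] [Algebra ℂ R]

/-- `ρ'` is a deformation of `ρ` over `R`, where `ev : R → ℂ` is the base point. -/
def IsDeformation (ev : R →+* ℂ) (ρ : Rep t s n ℂ) (ρ' : Rep t s n R) : Prop :=
  ∀ h : DAHA t s, (ρ' h).map ev = ρ h

/-- The deformation `ρ'` of `ρ` is trivial: it is isomorphic to the constant one by an
isomorphism which is the identity at the base point. -/
def IsTrivialDeformation (ev : R →+* ℂ) (ρ : Rep t s n ℂ) (ρ' : Rep t s n R) : Prop :=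
  ∃ g : GL (Fin n) R, (g : Matrix (Fin n) (Fin n) R).map ev = 1 ∧
    ∀ h : DAHA t s, ρ' h =
      (g : Matrix (Fin n) (Fin n) R) * (ρ h).map (algebraMap ℂ R) *
        ((g⁻¹ : GL (Fin n) R) : Matrix _ _ R)

/-- Under the deformation `ρ'` of `ρ` the operator of the `i`-th generator stays in its
conjugacy class. -/
def PreservesClass (ev : R →+* ℂ) (ρ : Rep t s n ℂ) (ρ' : Rep t s n R) (i : DAHAGen) : Prop :=
  ∃ g : GL (Fin n) R, (g : Matrix (Fin n) (Fin n) R).map ev = 1 ∧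
    ρ' (gen t s i) =
      (g : Matrix (Fin n) (Fin n) R) * (ρ (gen t s i)).map (algebraMap ℂ R) *
        ((g⁻¹ : GL (Fin n) R) : Matrix _ _ R)

end Deformations

/-- Every one-parameter formal deformation, over `ℂ⟦x⟧`, is trivial. -/
def FormallyRigid (ρ : Rep t s n ℂ) : Prop :=
  ∀ ρ' : Rep t s n (PowerSeries ℂ),
    IsDeformation (PowerSeries.constantCoeff (R := ℂ)) ρ ρ' →
      IsTrivialDeformation (PowerSeries.constantCoeff (R := ℂ)) ρ ρ'

/-- In the space of all `n`-dimensional representations, every representation near `ρ` is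
isomorphic to `ρ`: the isomorphism class of `ρ` is an isolated point of the moduli space. -/
def LocallyRigid (ρ : Rep t s n ℂ) : Prop :=
  ∃ U ∈ 𝓝 (fun i : DAHAGen => ρ (gen t s i)),
    ∀ ρ' : Rep t s n ℂ, (fun i : DAHAGen => ρ' (gen t s i)) ∈ U → Equivalent ρ' ρ

/-- Every first-order deformation, over `ℂ[ε]`, is trivial, provided that it keeps in their
conjugacy classes those generators whose quadratic relation has a double root (for the other
generators this is automatic). Thus the Zariski tangent space at `ρ` of the moduli space of
irreducible representations with fixed Jordan forms of the generators vanishes.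
Without the proviso non-reduced directions appear: `T = t + ε` satisfies `(T - t) ^ 2 = 0`. -/
def InfinitesimallyRigid (ρ : Rep t s n ℂ) : Prop :=
  ∀ ρ' : Rep t s n (DualNumber ℂ),
    IsDeformation (TrivSqZeroExt.fstHom ℂ ℂ ℂ : DualNumber ℂ →ₐ[ℂ] ℂ).toRingHom ρ ρ' →
    (∀ i, t i ^ 2 = -1 →
      PreservesClass (TrivSqZeroExt.fstHom ℂ ℂ ℂ : DualNumber ℂ →ₐ[ℂ] ℂ).toRingHom ρ ρ' i) →
      IsTrivialDeformation (TrivSqZeroExt.fstHom ℂ ℂ ℂ : DualNumber ℂ →ₐ[ℂ] ℂ).toRingHom ρ ρ'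

/-- A representation is rigid if it admits no deformations: neither formal ones, nor actual
ones, nor infinitesimal ones. -/
def IsRigid (ρ : Rep t s n ℂ) : Prop :=
  FormallyRigid ρ ∧ LocallyRigid ρ ∧ InfinitesimallyRigid ρ

/-- `dim Ker (T - t)` for the `i`-th generator `T` and its parameter `t`. -/
def kerDim (ρ : Rep t s n ℂ) (i : DAHAGen) : ℕ :=
  Module.finrank ℂ
    (LinearMap.ker (Matrix.toLin' (ρ (gen t s i) - algebraMap ℂ _ (t i))))

/-- The dimension `2 (1 - n² + ∑ dᵢ (n - dᵢ))` of the moduli space of irreducible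
representations whose generators have the same Jordan forms as those of `ρ`. -/
def moduliDim (ρ : Rep t s n ℂ) : ℤ :=
  2 * (1 - (n : ℤ) ^ 2 + ∑ i, (kerDim ρ i : ℤ) * ((n : ℤ) - (kerDim ρ i : ℤ)))

end DAHA

end

/-! A representation of `H` is a quadruple of invertible matrices with scalar product, each killed
by a quadratic polynomial. Up to the scalar it is a local system on the four-punctured sphere, and
its numerical data (the dimension `n` and the ranks `rᵢ` of `Tᵢ - tᵢ`) form a dimension vector of
the affine `D₄` quiver.

Scott's lemma, applied to the action on `Hom(ρ, ρ')` by `X ↦ T X T⁻¹`, gives `dim Hom(ρ, ρ') + dim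
Hom(ρ', ρ) ≥ (ρ, ρ')`, where `(ρ, ρ') = 2nn' - ∑ (n'rᵢ + nrᵢ' - 2rᵢrᵢ')` is the symmetric Euler form
(`two_mul_card_mul_card_le`). The associated Tits form satisfies `4 titsForm = ∑ (n - 2rᵢ)²`, so it
is nonnegative and vanishes only if every `rᵢ` equals `n/2`. In that case the determinant of the
product relation reads `q ^ (n/2) = 1`. Hence, for `q` not a root of unity, the form is at least `1`
on every nonzero representation, irreducible or not (`one_le_titsForm`). For irreducible `ρ`,
Schur's lemma bounds it above by `1`, and the dimension formula follows.

Rigidity comes from the same inequality. Ranks are lower semicontinuous. If the quadratic polynomial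
has simple roots, the ranks of `T - t` and of `T + t⁻¹` add up to `n`, so neither can jump; at a
double root a jump is possible but does no harm to the estimate. Therefore the Euler form of `ρ` and
a deformation is positive, an intertwiner exists, and irreducibility makes it invertible. The formal
case runs this over the fraction field of `ℂ⟦x⟧`. The first-order case views a representation over
`ℂ[ε]` as a self-extension of `ρ` of dimension `2n`, for which the inequality yields too many
homomorphisms to be accounted for by `End ρ` alone. -/

namespace Matrix

/-! ### Linear algebra of matrices with `N² = cN`. -/

section RankFactorization

variable {K : Type*} [Field K] {m m' : Type*} [Fintype m] [Fintype m']

/-- A matrix of rank `r` factors through `K ^ r`, by a split injection after a split surjection. -/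
theorem exists_rank_factorization (N : Matrix m m K) {r : ℕ} (hr : N.rank = r) :
    ∃ (B : Matrix m (Fin r) K) (C : Matrix (Fin r) m K) (P : Matrix (Fin r) m K)
      (Q : Matrix m (Fin r) K), N = B * C ∧ P * B = 1 ∧ C * Q = 1 := by
  classical
  let f := N.mulVecLin
  let e : LinearMap.range f ≃ₗ[K] (Fin r → K) :=
    (Module.finBasisOfFinrankEq K (LinearMap.range f) hr).equivFun
  let b : (Fin r → K) →ₗ[K] (m → K) := (LinearMap.range f).subtype ∘ₗ e.symm.toLinearMap
  let c : (m → K) →ₗ[K] (Fin r → K) := e.toLinearMap ∘ₗ f.rangeRestrict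
  have hb : LinearMap.ker b = ⊥ := by
    rw [LinearMap.ker_eq_bot]
    exact (Subtype.val_injective).comp e.symm.injective
  have hc : LinearMap.range c = ⊤ := by
    rw [LinearMap.range_eq_top]
    exact e.surjective.comp f.surjective_rangeRestrict
  obtain ⟨p, hp⟩ := b.exists_leftInverse_of_injective hb
  obtain ⟨q, hq⟩ := c.exists_rightInverse_of_surjective hc
  refine ⟨LinearMap.toMatrix' b, LinearMap.toMatrix' c, LinearMap.toMatrix' p,
    LinearMap.toMatrix' q, ?_, ?_, ?_⟩
  · rw [← LinearMap.toMatrix'_comp]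
    have : b ∘ₗ c = f := by ext x; simp [b, c]
    rw [this]
    exact (LinearMap.toMatrix'_toLin' N).symm
  · rw [← LinearMap.toMatrix'_comp, hp, LinearMap.toMatrix'_id]
  · rw [← LinearMap.toMatrix'_comp, hq, LinearMap.toMatrix'_id]

theorem exists_mul_mul_eq_one (N : Matrix m m K) :
    ∃ (P : Matrix (Fin N.rank) m K) (Q : Matrix m (Fin N.rank) K), P * N * Q = 1 := by
  obtain ⟨B, C, P, Q, h, hP, hQ⟩ := exists_rank_factorization N rfl
  refine ⟨P, Q, ?_⟩
  calc P * N * Q = P * (B * C) * Q := by rw [← h]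
    _ = 1 := by rw [← Matrix.mul_assoc, hP, Matrix.one_mul, hQ]

theorem card_le_rank_of_det_ne_zero {ι : Type*} [Fintype ι] [DecidableEq ι] (N : Matrix m m K)
    (P : Matrix ι m K) (Q : Matrix m ι K) (h : (P * N * Q).det ≠ 0) :
    Fintype.card ι ≤ N.rank := by
  rw [← rank_of_det_ne_zero h]
  exact (rank_mul_le_left _ _).trans (rank_mul_le_right _ _)

/-- `N² = cN` reads `B(CB)C = cBC`; the one-sided inverses `P` and `Q` cancel the outer factors. No
assumption `c ≠ 0` is needed, so double roots are covered. -/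
theorem mul_eq_smul_one_of_factorization {r : ℕ} {N : Matrix m m K} {c : K}
    {B : Matrix m (Fin r) K} {C P : Matrix (Fin r) m K}
    {Q : Matrix m (Fin r) K} (h : N = B * C) (hP : P * B = 1) (hQ : C * Q = 1)
    (hN : N * N = c • N) : C * B = c • (1 : Matrix (Fin r) (Fin r) K) := by
  have : P * (N * N) * Q = P * (c • N) * Q := by rw [hN]
  rw [h] at this
  have h1 : P * (B * C * (B * C)) * Q = (P * B) * (C * B) * (C * Q) := by
    simp only [Matrix.mul_assoc]
  have h2 : P * (c • (B * C)) * Q = c • ((P * B) * (C * Q)) := by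
    simp only [Matrix.mul_assoc, Matrix.mul_smul, Matrix.smul_mul]
  rw [h1, h2, hP, hQ] at this
  simpa using this

/-- The determinant of `a + N` if `N ^ 2 = c N`. -/
theorem det_add_of_mul_self_eq_smul [DecidableEq m] {N : Matrix m m K} {c a : K} (hN : N * N = c • N)
    (ha : a ≠ 0) : (a • (1 : Matrix m m K) + N).det =
      a ^ Fintype.card m * (1 + a⁻¹ * c) ^ N.rank := by
  obtain ⟨B, C, P, Q, h, hP, hQ⟩ := exists_rank_factorization N rfl
  have hCB := mul_eq_smul_one_of_factorization h hP hQ hN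
  -- Sylvester's identity moves the determinant to size `r`, where `CB = c` is scalar.
  have h1 : a • (1 : Matrix m m K) + N = a • (1 + (a⁻¹ • B) * C) := by
    nth_rw 1 [h]
    simp [smul_smul, ha]
  rw [h1, det_smul, det_one_add_mul_comm]
  have h2 : (1 + C * (a⁻¹ • B)) = (1 + a⁻¹ * c) • (1 : Matrix (Fin N.rank) (Fin N.rank) K) := by
    rw [Matrix.mul_smul, hCB, smul_smul, add_smul, one_smul]
  rw [h2, det_smul, det_one, mul_one, Fintype.card_fin]

/-- Every vector splits as `v = N(c⁻¹v) - (N - c)(c⁻¹v)`. -/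
theorem card_le_rank_add_rank_sub [DecidableEq m] (N : Matrix m m K) {c : K} (hc : c ≠ 0) :
    Fintype.card m ≤ N.rank + (N - c • 1).rank := by
  have h1 : (⊤ : Submodule K (m → K)) ≤
      LinearMap.range N.mulVecLin ⊔ LinearMap.range (N - c • 1).mulVecLin := by
    intro v _
    rw [Submodule.mem_sup]
    refine ⟨_, ⟨c⁻¹ • v, rfl⟩, _, ⟨-(c⁻¹ • v), rfl⟩, ?_⟩
    simp [Matrix.mulVec_neg, Matrix.mulVec_smul, smul_smul,
      hc]
  have h2 := (Submodule.finrank_mono h1).trans (Submodule.finrank_add_le_finrank_add_finrank _ _)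
  rwa [finrank_top, Module.finrank_fintype_fun_eq_card] at h2

/-- The linear map `X ↦ N' X - X N`. -/
def intertwineMap (N' : Matrix m' m' K) (N : Matrix m m K) :
    Matrix m' m K →ₗ[K] Matrix m' m K where
  toFun X := N' * X - X * N
  map_add' X Y := by simp only [Matrix.mul_add, Matrix.add_mul]; abel
  map_smul' a X := by simp [smul_sub]

/-- The rank of `X ↦ N' X - X N` if `N` and `N'` satisfy the same quadratic equation. -/
theorem finrank_range_intertwineMap_le {N' : Matrix m' m' K} {N : Matrix m m K} {c : K}
    (hN' : N' * N' = c • N') (hN : N * N = c • N) :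
    Module.finrank K (LinearMap.range (intertwineMap N' N)) + 2 * (N.rank * N'.rank) ≤
      Fintype.card m' * N.rank + Fintype.card m * N'.rank := by
  obtain ⟨r, hr⟩ : ∃ r, N.rank = r := ⟨_, rfl⟩
  obtain ⟨r', hr'⟩ : ∃ r', N'.rank = r' := ⟨_, rfl⟩
  obtain ⟨B, C, P, Q, h, hP, hQ⟩ := exists_rank_factorization N hr
  obtain ⟨B', C', P', Q', h', hP', hQ'⟩ := exists_rank_factorization N' hr'
  rw [hr, hr']
  have hCB := mul_eq_smul_one_of_factorization h hP hQ hN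
  have hCB' := mul_eq_smul_one_of_factorization h' hP' hQ' hN'
  -- Since `N'X - XN = B'(C'X) - (XB)C`, the map factors through pairs `(C'X, XB)`. These lie in
  -- `ker Ψ`, of dimension `r'm + m'r - rr'`. The pairs `(gC, B'g)` also lie there and are killed by
  -- `Φ`, because `CB` and `C'B'` are the same scalar; this removes another `rr'`.
  let Ψ : (Matrix (Fin r') m K × Matrix m' (Fin r) K) →ₗ[K] Matrix (Fin r') (Fin r) K :=
    { toFun := fun X => C' * X.2 - X.1 * B
      map_add' := fun X Y => by
        simp only [Prod.fst_add, Prod.snd_add, Matrix.mul_add, Matrix.add_mul]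
        abel
      map_smul' := fun a X => by simp [smul_sub] }
  let Φ : (Matrix (Fin r') m K × Matrix m' (Fin r) K) →ₗ[K] Matrix m' m K :=
    { toFun := fun X => B' * X.1 - X.2 * C
      map_add' := fun X Y => by
        simp only [Prod.fst_add, Prod.snd_add, Matrix.mul_add, Matrix.add_mul]
        abel
      map_smul' := fun a X => by simp [smul_sub] }
  let Θ : Matrix (Fin r') (Fin r) K →ₗ[K] (Matrix (Fin r') m K × Matrix m' (Fin r) K) :=
    { toFun := fun g => (g * C, B' * g)
      map_add' := fun X Y => by simp [Matrix.mul_add, Matrix.add_mul]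
      map_smul' := fun a X => by simp }
  have hΨ : LinearMap.range Ψ = ⊤ := by
    rw [LinearMap.range_eq_top]
    intro Y
    refine ⟨(-(Y * P), 0), ?_⟩
    simp [Ψ, Matrix.mul_assoc, hP]
  have hΨdim := Ψ.finrank_range_add_finrank_ker
  rw [hΨ, finrank_top] at hΨdim
  have hΘ : Function.Injective Θ := by
    intro X Y hXY
    have h1 : X * C = Y * C := congrArg Prod.fst hXY
    have h2 : X * C * Q = Y * C * Q := by rw [h1]
    simpa [Matrix.mul_assoc, hQ] using h2
  have hΘΨ : ∀ g, Θ g ∈ LinearMap.ker Ψ := by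
    intro g
    simp only [Θ, Ψ, LinearMap.mem_ker, LinearMap.coe_mk, AddHom.coe_mk]
    rw [← Matrix.mul_assoc, hCB', Matrix.mul_assoc, hCB]
    simp
  let Φ' := Φ ∘ₗ (LinearMap.ker Ψ).subtype
  let Θ' : Matrix (Fin r') (Fin r) K →ₗ[K] LinearMap.ker Φ' :=
    (Θ.codRestrict (LinearMap.ker Ψ) hΘΨ).codRestrict (LinearMap.ker Φ') (by
      intro g
      simp [Φ', Φ, Θ, Matrix.mul_assoc])
  have hΘ' : Function.Injective Θ' := fun X Y hXY => hΘ
    (congrArg (fun z : LinearMap.ker Φ' => z.1.1) hXY)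
  have h1 := LinearMap.finrank_le_finrank_of_injective hΘ'
  have h2 := Φ'.finrank_range_add_finrank_ker
  have h3 : LinearMap.range (intertwineMap N' N) ≤ LinearMap.range Φ' := by
    rintro _ ⟨X, rfl⟩
    refine ⟨⟨(C' * X, X * B), ?_⟩, ?_⟩
    · simp [Ψ, Matrix.mul_assoc]
    · simp [Φ', Φ, intertwineMap]
      rw [← Matrix.mul_assoc, ← h', Matrix.mul_assoc, ← h]
  have h4 := Submodule.finrank_mono h3
  simp only [Module.finrank_prod, Module.finrank_matrix, Module.finrank_self, Fintype.card_fin,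
    mul_one] at hΨdim h1
  have h5 : r' * r = r * r' := mul_comm _ _
  have h6 : r' * Fintype.card m = Fintype.card m * r' := mul_comm _ _
  omega

end RankFactorization

end Matrix

/-- **Scott's lemma** for four operators with product `1`. -/
theorem LinearMap.two_mul_finrank_le_of_mul_eq_one {K W : Type*} [Field K] [AddCommGroup W]
    [Module K W] [FiniteDimensional K W] (x₁ x₂ x₃ x₄ : Module.End K W)
    (h : x₁ * x₂ * x₃ * x₄ = 1) (I : Submodule K W) (J : Submodule K (Module.Dual K W))
    (hI : ∀ w, x₁ w = w → x₂ w = w → x₃ w = w → x₄ w = w → w ∈ I)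
    (hJ : ∀ φ : Module.Dual K W, φ ∘ₗ x₁ = φ → φ ∘ₗ x₂ = φ → φ ∘ₗ x₃ = φ → φ ∘ₗ x₄ = φ → φ ∈ J) :
    2 * Module.finrank K W ≤
      Module.finrank K (LinearMap.range (x₁ - 1)) + Module.finrank K (LinearMap.range (x₂ - 1)) +
      Module.finrank K (LinearMap.range (x₃ - 1)) + Module.finrank K (LinearMap.range (x₄ - 1)) +
      Module.finrank K I + Module.finrank K J := by
  -- The composite `β ∘ α` telescopes to `x₁x₂x₃x₄ - 1 = 0`. The kernel of `α` consists of
  -- invariants, and the annihilator of the image of `β` of invariant linear forms, so `range α ≤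
  -- ker β` is the desired inequality.
  let β : (LinearMap.range (x₁ - 1) × LinearMap.range (x₂ - 1) × LinearMap.range (x₃ - 1) ×
      LinearMap.range (x₄ - 1)) →ₗ[K] W :=
    (LinearMap.range (x₁ - 1)).subtype.coprod
      ((x₁ ∘ₗ (LinearMap.range (x₂ - 1)).subtype).coprod
        (((x₁ * x₂) ∘ₗ (LinearMap.range (x₃ - 1)).subtype).coprod
          ((x₁ * x₂ * x₃) ∘ₗ (LinearMap.range (x₄ - 1)).subtype)))
  let α : W →ₗ[K] (LinearMap.range (x₁ - 1) × LinearMap.range (x₂ - 1) × LinearMap.range (x₃ - 1) ×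
      LinearMap.range (x₄ - 1)) :=
    (x₁ - 1).rangeRestrict.prod ((x₂ - 1).rangeRestrict.prod
      ((x₃ - 1).rangeRestrict.prod (x₄ - 1).rangeRestrict))
  have hβ : ∀ a b c d, β (a, b, c, d) = a + x₁ b + x₁ (x₂ c) + x₁ (x₂ (x₃ d)) := by
    intro a b c d
    simp [β, add_assoc]
  have hαβ : LinearMap.range α ≤ LinearMap.ker β := by
    rintro _ ⟨w, rfl⟩
    have h1 : x₁ (x₂ (x₃ (x₄ w))) = w := by
      simpa using congrArg (fun f => f w) h
    change β (_, _, _, _) = 0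
    rw [hβ]
    simp [h1]
  have hα : LinearMap.ker α ≤ I := by
    intro w hw
    have hw' : α w = 0 := hw
    have h1 := congrArg (fun p => p.1) hw'
    have h2 := congrArg (fun p => p.2.1) hw'
    have h3 := congrArg (fun p => p.2.2.1) hw'
    have h4 := congrArg (fun p => p.2.2.2) hw'
    have key : ∀ x : Module.End K W, (x - 1).rangeRestrict w = 0 → x w = w := by
      intro x hx
      have := congrArg Subtype.val hx
      simpa [sub_eq_zero] using this
    exact hI w (key _ h1) (key _ h2) (key _ h3) (key _ h4)
  have hJ' : (LinearMap.range β).dualAnnihilator ≤ J := by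
    intro φ hφ
    rw [Submodule.mem_dualAnnihilator] at hφ
    have hφ' : ∀ a b c d, φ (β (a, b, c, d)) = 0 := fun a b c d => hφ _ ⟨_, rfl⟩
    simp only [hβ] at hφ'
    have e1 : ∀ w, φ (x₁ w) = φ w := by
      intro w
      have := hφ' ⟨_, ⟨w, rfl⟩⟩ 0 0 0
      simpa [sub_eq_zero] using this
    have e2 : ∀ w, φ (x₂ w) = φ w := by
      intro w
      have := hφ' 0 ⟨_, ⟨w, rfl⟩⟩ 0 0
      simpa [sub_eq_zero, e1] using this
    have e3 : ∀ w, φ (x₃ w) = φ w := by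
      intro w
      have := hφ' 0 0 ⟨_, ⟨w, rfl⟩⟩ 0
      simpa [sub_eq_zero, e1, e2] using this
    have e4 : ∀ w, φ (x₄ w) = φ w := by
      intro w
      have := hφ' 0 0 0 ⟨_, ⟨w, rfl⟩⟩
      simpa [sub_eq_zero, e1, e2, e3] using this
    exact hJ φ (LinearMap.ext e1) (LinearMap.ext e2) (LinearMap.ext e3) (LinearMap.ext e4)
  have i1 := Submodule.finrank_mono hαβ
  have i2 := Submodule.finrank_mono hα
  have i3 := Submodule.finrank_mono hJ'
  have i4 := α.finrank_range_add_finrank_ker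
  have i5 := β.finrank_range_add_finrank_ker
  have i6 := Subspace.finrank_add_finrank_dualAnnihilator_eq (LinearMap.range β)
  simp only [Module.finrank_prod] at i5
  omega

theorem DAHAGen.sum_eq {M : Type*} [AddCommMonoid M] (f : DAHAGen → M) :
    ∑ i, f i = f .T0 + f .T1 + f .T0v + f .T1v := by
  have : (Finset.univ : Finset DAHAGen) = {.T0, .T1, .T0v, .T1v} := rfl
  rw [this]
  simp [add_assoc]

namespace DAHA

/-! ### Consequences of the defining relations of `H`. -/

section Relations

variable {t : DAHAGen → ℂ} {s : ℂ}

/-- The element `T - t` of `H`, for the generator `T` with label `i` and its parameter `t`. -/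
noncomputable def shift (t : DAHAGen → ℂ) (s : ℂ) (i : DAHAGen) : DAHA t s :=
  gen t s i - algebraMap ℂ _ (t i)

/-- The other root of the polynomial of `T - t`. -/
noncomputable def shiftRoot (t : DAHAGen → ℂ) (i : DAHAGen) : ℂ := -(t i + (t i)⁻¹)

theorem gen_eq_shift_add (i : DAHAGen) :
    gen t s i = shift t s i + algebraMap ℂ _ (t i) := by
  simp [shift]

theorem gen_quadratic (i : DAHAGen) :
    (gen t s i - algebraMap ℂ _ (t i)) * (gen t s i + algebraMap ℂ _ (t i)⁻¹) = 0 := by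
  have h := RingQuot.mkAlgHom_rel ℂ (DAHARel.quadratic (t := t) (s := s) i)
  simpa [gen] using h

theorem gen_product :
    gen t s .T1v * gen t s .T1 * gen t s .T0 * gen t s .T0v = algebraMap ℂ _ s⁻¹ := by
  have h := RingQuot.mkAlgHom_rel ℂ (DAHARel.product (t := t) (s := s))
  rw [map_mul, map_mul, map_mul, AlgHom.commutes] at h
  exact h

theorem shift_mul_self (i : DAHAGen) :
    shift t s i * shift t s i = shiftRoot t i • shift t s i := by
  have h := gen_quadratic (t := t) (s := s) i
  rw [gen_eq_shift_add] at h
  simp only [add_sub_cancel_right, mul_add, ← Algebra.commutes, ← Algebra.smul_def] at h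
  rw [shiftRoot, ← sub_eq_zero, ← h]
  module

/-- The inverse of the `i`-th generator. -/
noncomputable def genInv (t : DAHAGen → ℂ) (s : ℂ) (i : DAHAGen) : DAHA t s :=
  gen t s i + algebraMap ℂ _ ((t i)⁻¹ - t i)

theorem gen_mul_genInv (ht : ∀ i, t i ≠ 0) (i : DAHAGen) :
    gen t s i * genInv t s i = 1 := by
  have h := gen_quadratic (t := t) (s := s) i
  have h1 : algebraMap ℂ (DAHA t s) (t i) * algebraMap ℂ (DAHA t s) (t i)⁻¹ = 1 := by
    rw [← map_mul, mul_inv_cancel₀ (ht i), map_one]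
  rw [sub_mul, mul_add, mul_add, h1, Algebra.commutes] at h
  rw [genInv, map_sub, mul_add, mul_sub, ← sub_eq_zero, ← h]
  abel

theorem genInv_mul_gen (ht : ∀ i, t i ≠ 0) (i : DAHAGen) :
    genInv t s i * gen t s i = 1 := by
  rw [← gen_mul_genInv (s := s) ht i, genInv, add_mul, mul_add, Algebra.commutes]

/-- A property closed under the algebra operations holds on `H` if it holds on generators. -/
theorem induction_gen {p : DAHA t s → Prop} (hc : ∀ c, p (algebraMap ℂ _ c))
    (hg : ∀ i, p (gen t s i)) (hmul : ∀ a b, p a → p b → p (a * b))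
    (hadd : ∀ a b, p a → p b → p (a + b)) (h : DAHA t s) : p h := by
  obtain ⟨a, rfl⟩ := RingQuot.mkAlgHom_surjective ℂ (DAHARel t s) h
  induction a using FreeAlgebra.induction with
  | grade0 c => rw [AlgHom.commutes]; exact hc c
  | grade1 i => exact hg i
  | mul a b ha hb => rw [map_mul]; exact hmul _ _ ha hb
  | add a b ha hb => rw [map_add]; exact hadd _ _ ha hb

theorem intertwine_of_gen {R : Type*} [CommRing R] [Algebra ℂ R] {m m' : Type*} [Fintype m]
    [Fintype m'] [DecidableEq m] [DecidableEq m'] (ρ : DAHA t s →ₐ[ℂ] Matrix m m R)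
    (ρ' : DAHA t s →ₐ[ℂ] Matrix m' m' R) (X : Matrix m' m R)
    (hX : ∀ i, ρ' (gen t s i) * X = X * ρ (gen t s i)) (h : DAHA t s) :
    ρ' h * X = X * ρ h := by
  induction h using induction_gen with
  | hc c => simp [Algebra.algebraMap_eq_smul_one]
  | hg i => exact hX i
  | hmul a b ha hb => rw [map_mul, map_mul, Matrix.mul_assoc, hb, ← Matrix.mul_assoc, ha,
      Matrix.mul_assoc]
  | hadd a b ha hb => rw [map_add, map_add, Matrix.add_mul, Matrix.mul_add, ha, hb]

end Relations

/-! ### Duality of matrix spaces by the trace pairing. -/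

section TraceDual

variable {K : Type*} [Field K] {m m' : Type*} [Fintype m] [Fintype m'] [DecidableEq m]
  [DecidableEq m']

/-- The matrix representing a linear form on matrices by the trace pairing. -/
noncomputable def traceDual (K : Type*) [Field K] (m m' : Type*) [Fintype m] [Fintype m'] [DecidableEq m]
    [DecidableEq m'] : Module.Dual K (Matrix m' m K) →ₗ[K] Matrix m m' K where
  toFun φ := Matrix.of fun i j => φ (Matrix.single j i 1)
  map_add' φ ψ := by ext; simp
  map_smul' c φ := by ext; simp

theorem trace_traceDual_mul (φ : Module.Dual K (Matrix m' m K)) (X : Matrix m' m K) :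
    (traceDual K m m' φ * X).trace = φ X := by
  conv_rhs => rw [Matrix.matrix_eq_sum_single X]
  simp only [Matrix.trace, Matrix.diag_apply, Matrix.mul_apply, map_sum]
  rw [Finset.sum_comm]
  refine Finset.sum_congr rfl fun j _ => Finset.sum_congr rfl fun i _ => ?_
  have : Matrix.single j i (X j i) = X j i • Matrix.single j i (1 : K) := by simp
  rw [this, map_smul, smul_eq_mul, mul_comm]
  rfl

theorem traceDual_injective : Function.Injective (traceDual K m m') := by
  intro φ ψ h
  ext X
  rw [← trace_traceDual_mul, h, trace_traceDual_mul]

end TraceDual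

/-! ### The Euler form and intertwiners. -/

section Euler

variable {t : DAHAGen → ℂ} {s : ℂ} {K : Type*} [Field K] [Algebra ℂ K] {m m' : Type*} [Fintype m]
  [Fintype m'] [DecidableEq m] [DecidableEq m']

/-- The rank of `T - t` for the `i`-th generator. -/
noncomputable def shiftRank (ρ : DAHA t s →ₐ[ℂ] Matrix m m K) (i : DAHAGen) : ℕ := (ρ (shift t s i)).rank

theorem map_shift_mul_self (ρ : DAHA t s →ₐ[ℂ] Matrix m m K) (i : DAHAGen) :
    ρ (shift t s i) * ρ (shift t s i) = algebraMap ℂ K (shiftRoot t i) • ρ (shift t s i) := by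
  rw [← map_mul, shift_mul_self, map_smul, algebraMap_smul]

/-- The space of intertwining operators. -/
noncomputable def intertwiners (ρ : DAHA t s →ₐ[ℂ] Matrix m m K) (ρ' : DAHA t s →ₐ[ℂ] Matrix m' m' K) :
    Submodule K (Matrix m' m K) where
  carrier := {X | ∀ h, ρ' h * X = X * ρ h}
  add_mem' hX hY h := by rw [Matrix.mul_add, Matrix.add_mul, hX h, hY h]
  zero_mem' h := by simp
  smul_mem' c X hX h := by rw [Matrix.mul_smul, Matrix.smul_mul, hX h]

/-- The conjugation `X ↦ T X T⁻¹` by the `i`-th generator. -/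
noncomputable def conjGen (ρ : DAHA t s →ₐ[ℂ] Matrix m m K) (ρ' : DAHA t s →ₐ[ℂ] Matrix m' m' K) (i : DAHAGen) :
    Module.End K (Matrix m' m K) where
  toFun X := ρ' (gen t s i) * X * ρ (genInv t s i)
  map_add' X Y := by rw [Matrix.mul_add, Matrix.add_mul]
  map_smul' c X := by simp

theorem conjGen_apply (ρ : DAHA t s →ₐ[ℂ] Matrix m m K) (ρ' : DAHA t s →ₐ[ℂ] Matrix m' m' K)
    (i : DAHAGen) (X : Matrix m' m K) :
    conjGen ρ ρ' i X = ρ' (gen t s i) * X * ρ (genInv t s i) := rfl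

theorem map_gen_mul_map_genInv (ht : ∀ i, t i ≠ 0) (ρ : DAHA t s →ₐ[ℂ] Matrix m m K)
    (i : DAHAGen) : ρ (gen t s i) * ρ (genInv t s i) = 1 := by
  rw [← map_mul, gen_mul_genInv ht, map_one]

theorem map_genInv_mul_map_gen (ht : ∀ i, t i ≠ 0) (ρ : DAHA t s →ₐ[ℂ] Matrix m m K)
    (i : DAHAGen) : ρ (genInv t s i) * ρ (gen t s i) = 1 := by
  rw [← map_mul, genInv_mul_gen ht, map_one]

/-- `TXT⁻¹ - X = (N'X - XN)T⁻¹` with `N = T - t`, since the scalar `t` cancels; multiplication by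
`T⁻¹` does not increase the rank. -/
theorem finrank_range_conjGen_sub_one_le (ht : ∀ i, t i ≠ 0) (ρ : DAHA t s →ₐ[ℂ] Matrix m m K)
    (ρ' : DAHA t s →ₐ[ℂ] Matrix m' m' K) (i : DAHAGen) :
    Module.finrank K (LinearMap.range (conjGen ρ ρ' i - 1)) +
        2 * (shiftRank ρ i * shiftRank ρ' i) ≤
      Fintype.card m' * shiftRank ρ i + Fintype.card m * shiftRank ρ' i := by
  refine le_trans (Nat.add_le_add_right ?_ _)
    (Matrix.finrank_range_intertwineMap_le (map_shift_mul_self ρ' i) (map_shift_mul_self ρ i))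
  let R : Matrix m' m K →ₗ[K] Matrix m' m K :=
    { toFun := fun X => X * ρ (genInv t s i)
      map_add' := fun X Y => Matrix.add_mul _ _ _
      map_smul' := fun c X => by simp }
  have h : conjGen ρ ρ' i - 1 =
      R ∘ₗ Matrix.intertwineMap (ρ' (shift t s i)) (ρ (shift t s i)) := by
    ext1 X
    have h1 : X * ρ (gen t s i) * ρ (genInv t s i) = X := by
      rw [Matrix.mul_assoc, map_gen_mul_map_genInv ht, Matrix.mul_one]
    have h2 : ρ' (shift t s i) * X - X * ρ (shift t s i) =
        ρ' (gen t s i) * X - X * ρ (gen t s i) := by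
      simp [gen_eq_shift_add, Matrix.add_mul, Matrix.mul_add, Algebra.algebraMap_eq_smul_one]
    change ρ' (gen t s i) * X * ρ (genInv t s i) - X =
      (ρ' (shift t s i) * X - X * ρ (shift t s i)) * ρ (genInv t s i)
    rw [h2, Matrix.sub_mul, h1]
  rw [h, LinearMap.range_comp]
  exact Submodule.finrank_map_le _ _

theorem conjGen_product (hs : s ≠ 0) (ht : ∀ i, t i ≠ 0) (ρ : DAHA t s →ₐ[ℂ] Matrix m m K)
    (ρ' : DAHA t s →ₐ[ℂ] Matrix m' m' K) :
    conjGen ρ ρ' .T1v * conjGen ρ ρ' .T1 * conjGen ρ ρ' .T0 * conjGen ρ ρ' .T0v = 1 := by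
  ext1 X
  have h1 : ρ' (gen t s .T1v) * (ρ' (gen t s .T1) * (ρ' (gen t s .T0) * ρ' (gen t s .T0v))) =
      algebraMap ℂ K s⁻¹ • 1 := by
    rw [← map_mul, ← map_mul, ← map_mul, ← mul_assoc, ← mul_assoc, gen_product, AlgHom.commutes,
      Algebra.algebraMap_eq_smul_one, algebraMap_smul]
  have h3 : genInv t s .T0v * genInv t s .T0 * genInv t s .T1 * genInv t s .T1v =
      algebraMap ℂ _ s := by
    have e := gen_product (t := t) (s := s)
    have e1 : (genInv t s .T0v * genInv t s .T0 * genInv t s .T1 * genInv t s .T1v) *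
        (gen t s .T1v * gen t s .T1 * gen t s .T0 * gen t s .T0v) = 1 := by
      simp only [mul_assoc]
      rw [← mul_assoc (genInv t s .T1v), genInv_mul_gen ht, one_mul,
        ← mul_assoc (genInv t s .T1), genInv_mul_gen ht, one_mul,
        ← mul_assoc (genInv t s .T0), genInv_mul_gen ht, one_mul, genInv_mul_gen ht]
    rw [e] at e1
    calc _ = (genInv t s .T0v * genInv t s .T0 * genInv t s .T1 * genInv t s .T1v) *
        (algebraMap ℂ _ s⁻¹ * algebraMap ℂ _ s) := by
          rw [← map_mul, inv_mul_cancel₀ hs, map_one, mul_one]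
      _ = _ := by rw [← mul_assoc, e1, one_mul]
  have h2 : ρ (genInv t s .T0v) * (ρ (genInv t s .T0) * (ρ (genInv t s .T1) *
      ρ (genInv t s .T1v))) = algebraMap ℂ K s • 1 := by
    rw [← map_mul, ← map_mul, ← map_mul, ← mul_assoc, ← mul_assoc, h3, AlgHom.commutes,
      Algebra.algebraMap_eq_smul_one, algebraMap_smul]
  simp only [Module.End.mul_apply, conjGen_apply, Module.End.one_apply]
  calc _ = (ρ' (gen t s .T1v) * (ρ' (gen t s .T1) * (ρ' (gen t s .T0) * ρ' (gen t s .T0v)))) * X *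
        (ρ (genInv t s .T0v) * (ρ (genInv t s .T0) * (ρ (genInv t s .T1) *
          ρ (genInv t s .T1v)))) := by simp only [Matrix.mul_assoc]
    _ = X := by
      rw [h1, h2, Matrix.smul_mul, Matrix.one_mul, Matrix.mul_smul, Matrix.mul_one, smul_smul,
        ← map_mul, mul_inv_cancel₀ hs, map_one, one_smul]

theorem map_gen_mul_eq_of_conjGen_eq_self (ht : ∀ i, t i ≠ 0) (ρ : DAHA t s →ₐ[ℂ] Matrix m m K)
    (ρ' : DAHA t s →ₐ[ℂ] Matrix m' m' K) (i : DAHAGen) (X : Matrix m' m K)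
    (h : conjGen ρ ρ' i X = X) : ρ' (gen t s i) * X = X * ρ (gen t s i) := by
  rw [conjGen_apply] at h
  nth_rw 2 [← h]
  rw [Matrix.mul_assoc _ (ρ (genInv t s i)), map_genInv_mul_map_gen ht, Matrix.mul_one]

/-- The Euler form of two representations bounds the dimensions of intertwiners from below. -/
theorem two_mul_card_mul_card_le (hs : s ≠ 0) (ht : ∀ i, t i ≠ 0)
    (ρ : DAHA t s →ₐ[ℂ] Matrix m m K) (ρ' : DAHA t s →ₐ[ℂ] Matrix m' m' K) :
    (2 * (Fintype.card m' * Fintype.card m) : ℤ) ≤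
      ∑ i, ((Fintype.card m' * shiftRank ρ i + Fintype.card m * shiftRank ρ' i : ℤ) -
        2 * (shiftRank ρ i * shiftRank ρ' i)) +
      Module.finrank K (intertwiners ρ ρ') + Module.finrank K (intertwiners ρ' ρ) := by
  -- Invariant linear forms on `Hom(ρ, ρ')` are identified by the trace with intertwiners in the
  -- opposite direction.
  let J := (intertwiners ρ' ρ).comap (traceDual K m m')
  have h := LinearMap.two_mul_finrank_le_of_mul_eq_one _ _ _ _ (conjGen_product hs ht ρ ρ')
    (intertwiners ρ ρ') J ?_ ?_
  · have hJ : Module.finrank K J ≤ Module.finrank K (intertwiners ρ' ρ) := by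
      refine LinearMap.finrank_le_finrank_of_injective
        (f := ((traceDual K m m').restrict (p := J) (q := intertwiners ρ' ρ) fun x hx => hx)) ?_
      intro x y hxy
      exact Subtype.ext (traceDual_injective (congrArg Subtype.val hxy))
    have hb := finrank_range_conjGen_sub_one_le ht ρ ρ'
    have b1 := hb .T0
    have b2 := hb .T1
    have b3 := hb .T0v
    have b4 := hb .T1v
    rw [DAHAGen.sum_eq]
    rw [Module.finrank_matrix, Module.finrank_self, mul_one] at h
    zify at *
    linarith
  · intro X h1 h2 h3 h4
    refine intertwine_of_gen ρ ρ' X fun i => map_gen_mul_eq_of_conjGen_eq_self ht ρ ρ' i X ?_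
    cases i <;> assumption
  · intro φ h1 h2 h3 h4
    refine intertwine_of_gen ρ' ρ _ fun i => ?_
    have hφ : ∀ X, φ (conjGen ρ ρ' i X) = φ X := by
      intro X
      cases i
      · exact congrArg (fun f => f X) h3
      · exact congrArg (fun f => f X) h2
      · exact congrArg (fun f => f X) h4
      · exact congrArg (fun f => f X) h1
    rw [Matrix.ext_iff_trace_mul_right]
    intro X
    -- Invariance is tested at `X T`, so that the factor `T⁻¹` of the conjugation cancels.
    have h5 := hφ (X * ρ (gen t s i))
    rw [← trace_traceDual_mul, ← trace_traceDual_mul φ, conjGen_apply, Matrix.mul_assoc,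
      Matrix.mul_assoc, map_gen_mul_map_genInv ht, Matrix.mul_one] at h5
    rw [Matrix.mul_assoc (traceDual K m m' φ) _ X, h5, Matrix.mul_assoc, Matrix.trace_mul_comm, Matrix.mul_assoc]

end Euler

end DAHA

namespace DAHA

/-! ### Positivity of the Tits form. -/

section Index

variable {t : DAHAGen → ℂ} {s : ℂ} {K : Type*} [Field K] [Algebra ℂ K] {m : Type*} [Fintype m]
  [DecidableEq m]

theorem det_map_gen (ht : ∀ i, t i ≠ 0) (ρ : DAHA t s →ₐ[ℂ] Matrix m m K) (i : DAHAGen) :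
    (ρ (gen t s i)).det = algebraMap ℂ K (t i ^ Fintype.card m * (-(t i ^ 2)⁻¹) ^ shiftRank ρ i) := by
  have h1 : ρ (gen t s i) = algebraMap ℂ K (t i) • 1 + ρ (shift t s i) := by
    rw [gen_eq_shift_add, map_add, AlgHom.commutes, Algebra.algebraMap_eq_smul_one,
      algebraMap_smul, add_comm]
  have h2 : 1 + (algebraMap ℂ K (t i))⁻¹ * algebraMap ℂ K (shiftRoot t i) =
      algebraMap ℂ K (-(t i ^ 2)⁻¹) := by
    rw [← map_inv₀, ← map_mul, ← map_one (algebraMap ℂ K), ← map_add, shiftRoot]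
    congr 1
    field_simp [ht i]
    ring
  rw [h1, Matrix.det_add_of_mul_self_eq_smul (map_shift_mul_self ρ i) (by simpa using ht i), h2,
    map_mul, map_pow, map_pow, shiftRank]

/-- Otherwise `n = 2r` with all ranks `r`, every generator has determinant `(-1)^r` whatever its
parameter, and the product relation forces `q^r = 1`. -/
theorem exists_two_mul_shiftRank_ne (ht : ∀ i, t i ≠ 0)
    (hq : ∀ k : ℕ, 0 < k → (s ^ 2) ^ k ≠ 1) (hm : 0 < Fintype.card m)
    (ρ : DAHA t s →ₐ[ℂ] Matrix m m K) : ∃ i, 2 * shiftRank ρ i ≠ Fintype.card m := by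
  by_contra! h
  obtain ⟨r, hr⟩ : ∃ r, r = shiftRank ρ .T0 := ⟨_, rfl⟩
  have hr' : ∀ i, shiftRank ρ i = r := fun i => by have := h i; have := h .T0; omega
  have hcard : Fintype.card m = 2 * r := by rw [← h .T0, hr]
  have hdet : ∀ i, (ρ (gen t s i)).det = algebraMap ℂ K ((-1) ^ r) := by
    intro i
    rw [det_map_gen ht, hr', hcard, pow_mul, ← mul_pow]
    congr 2
    have := ht i
    field_simp
  have h1 := congrArg (fun x => (ρ x).det) (gen_product (t := t) (s := s))
  simp only [map_mul, Matrix.det_mul, hdet, AlgHom.commutes] at h1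
  have hA : algebraMap ℂ (Matrix m m K) s⁻¹ = algebraMap ℂ K s⁻¹ • 1 := by
    rw [Algebra.algebraMap_eq_smul_one, algebraMap_smul]
  rw [hA, Matrix.det_smul, Matrix.det_one, mul_one, ← map_mul, ← map_mul, ← map_mul, ← map_pow] at h1
  have h2 := (algebraMap ℂ K).injective h1
  rw [← pow_add, ← pow_add, ← pow_add, show r + r + r + r = 2 * (2 * r) by ring, pow_mul, hcard,
    neg_one_sq, one_pow, inv_pow, pow_mul] at h2
  refine hq r (by omega) ?_
  rw [← inv_inv ((s ^ 2) ^ r), ← h2, inv_one]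

/-- Half of the rigidity index of `ρ`, i.e. the Tits form of the affine `D₄` quiver at the
dimension vector of `ρ`. -/
noncomputable def titsForm (ρ : DAHA t s →ₐ[ℂ] Matrix m m K) : ℤ :=
  (Fintype.card m : ℤ) ^ 2 - ∑ i, (shiftRank ρ i : ℤ) * (Fintype.card m - shiftRank ρ i)

theorem one_le_titsForm (ht : ∀ i, t i ≠ 0)
    (hq : ∀ k : ℕ, 0 < k → (s ^ 2) ^ k ≠ 1) (hm : 0 < Fintype.card m)
    (ρ : DAHA t s →ₐ[ℂ] Matrix m m K) : 1 ≤ titsForm ρ := by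
  obtain ⟨i, hi⟩ := exists_two_mul_shiftRank_ne ht hq hm ρ
  have h1 : 4 * titsForm ρ = ∑ i, ((Fintype.card m : ℤ) - 2 * shiftRank ρ i) ^ 2 := by
    rw [titsForm, DAHAGen.sum_eq, DAHAGen.sum_eq]
    ring
  have h2 : 0 < ∑ i, ((Fintype.card m : ℤ) - 2 * shiftRank ρ i) ^ 2 := by
    refine Finset.sum_pos' (fun i _ => sq_nonneg _) ⟨i, Finset.mem_univ i, ?_⟩
    have : (Fintype.card m : ℤ) - 2 * shiftRank ρ i ≠ 0 := by omega
    positivity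
  omega

/-- At a double root `T - t` squares to zero. -/
theorem two_mul_shiftRank_le (ρ : DAHA t s →ₐ[ℂ] Matrix m m K) {i : DAHAGen}
    (hi : shiftRoot t i = 0) : 2 * shiftRank ρ i ≤ Fintype.card m := by
  have h := map_shift_mul_self ρ i
  rw [hi, map_zero, zero_smul] at h
  have := Matrix.rank_add_rank_le_card_of_mul_eq_zero h
  rw [shiftRank]
  omega

theorem map_shift_mul_sub (ρ : DAHA t s →ₐ[ℂ] Matrix m m K) (i : DAHAGen) :
    ρ (shift t s i) * (ρ (shift t s i) - algebraMap ℂ K (shiftRoot t i) • 1) = 0 := by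
  rw [mul_sub, map_shift_mul_self, Matrix.mul_smul, mul_one, sub_self]

theorem titsForm_le_finrank_intertwiners (hs : s ≠ 0) (ht : ∀ i, t i ≠ 0) (ρ : DAHA t s →ₐ[ℂ] Matrix m m K) :
    titsForm ρ ≤ Module.finrank K (intertwiners ρ ρ) := by
  have h := two_mul_card_mul_card_le hs ht ρ ρ
  rw [DAHAGen.sum_eq] at h
  rw [titsForm, DAHAGen.sum_eq]
  linarith

/-- If the ranks of `ρ'` do not drop below those of `ρ`, and do not change at generators with simple
roots, then there is a nonzero intertwiner in one of the two directions. -/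
theorem exists_ne_zero_intertwiner (hs : s ≠ 0) (ht : ∀ i, t i ≠ 0)
    (hq : ∀ k : ℕ, 0 < k → (s ^ 2) ^ k ≠ 1) (hm : 0 < Fintype.card m)
    (ρ ρ' : DAHA t s →ₐ[ℂ] Matrix m m K)
    (hle : ∀ i, shiftRank ρ i ≤ shiftRank ρ' i)
    (hge : ∀ i, shiftRoot t i ≠ 0 → shiftRank ρ' i ≤ shiftRank ρ i) :
    (∃ X ∈ intertwiners ρ ρ', X ≠ 0) ∨ (∃ X ∈ intertwiners ρ' ρ, X ≠ 0) := by
  -- Equivalently `(r' - r)(n - 2r') ≥ 0`, where `r`, `r'` are the ranks for `ρ`, `ρ'`. Summed over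
  -- the generators, this is half-way to `(ρ, ρ') ≥ 2 titsForm ρ'`: the difference of the two sides
  -- is exactly `∑ (r' - r)(n - 2r')`.
  have hstep : ∀ i, ((shiftRank ρ' i : ℤ) - shiftRank ρ i) *
      (Fintype.card m - shiftRank ρ i - shiftRank ρ' i) ≥ ((shiftRank ρ' i : ℤ) - shiftRank ρ i) ^ 2 := by
    intro i
    by_cases hi : shiftRoot t i = 0
    · have h1 := two_mul_shiftRank_le ρ' hi
      have h2 := hle i
      have h3 : (0 : ℤ) ≤ (shiftRank ρ' i : ℤ) - shiftRank ρ i := by omega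
      have h4 : (shiftRank ρ' i : ℤ) - shiftRank ρ i ≤
        Fintype.card m - shiftRank ρ i - shiftRank ρ' i := by omega
      rw [sq]
      exact mul_le_mul_of_nonneg_left h4 h3
    · have h1 : shiftRank ρ' i = shiftRank ρ i := le_antisymm (hge i hi) (hle i)
      simp [h1]
  have hρ' := one_le_titsForm ht hq hm ρ'
  have h0 := hstep .T0
  have h1 := hstep .T1
  have h2 := hstep .T0v
  have h3 := hstep .T1v
  have hK := two_mul_card_mul_card_le hs ht ρ ρ'
  rw [titsForm, DAHAGen.sum_eq] at hρ'
  rw [DAHAGen.sum_eq] at hK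
  have hdim : 0 < Module.finrank K (intertwiners ρ ρ') + Module.finrank K (intertwiners ρ' ρ) := by
    zify
    nlinarith only [hρ', h0, h1, h2, h3, hK]
  by_contra! hcon
  have e1 : intertwiners ρ ρ' = ⊥ := (Submodule.eq_bot_iff _).2 hcon.1
  have e2 : intertwiners ρ' ρ = ⊥ := (Submodule.eq_bot_iff _).2 hcon.2
  rw [e1, e2, finrank_bot] at hdim
  exact lt_irrefl _ hdim

end Index

/-! ### Schur's lemma and the dimension formula. -/

section Irreducible

variable {t : DAHAGen → ℂ} {s : ℂ} {n : ℕ}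

/-- Schur's lemma. -/
theorem IsIrreducible.exists_eq_smul_one {ρ : Rep t s n ℂ} (hρ : IsIrreducible ρ)
    {X : Matrix (Fin n) (Fin n) ℂ} (hX : ∀ h, ρ h * X = X * ρ h) : ∃ c : ℂ, X = c • 1 := by
  have : Nonempty (Fin n) := ⟨⟨0, hρ.1⟩⟩
  obtain ⟨c, hc⟩ := Module.End.exists_eigenvalue (Matrix.toLin' X)
  refine ⟨c, ?_⟩
  have hmem : ∀ v, v ∈ Module.End.eigenspace (Matrix.toLin' X) c ↔ X.mulVec v = c • v := by
    intro v
    rw [Module.End.mem_eigenspace_iff, Matrix.toLin'_apply]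
  rcases hρ.2 (Module.End.eigenspace (Matrix.toLin' X) c) (by
    intro h w hw
    rw [hmem] at hw ⊢
    rw [Matrix.mulVec_mulVec, ← hX, ← Matrix.mulVec_mulVec, hw, Matrix.mulVec_smul]) with h | h
  · exact absurd h hc
  · refine Matrix.toLin'.injective (LinearMap.ext fun v => ?_)
    have := (hmem v).1 (h ▸ Submodule.mem_top)
    rw [Matrix.toLin'_apply, this]
    simp

theorem IsIrreducible.finrank_intertwiners_le {ρ : Rep t s n ℂ} (hρ : IsIrreducible ρ) :
    Module.finrank ℂ (intertwiners ρ ρ) ≤ 1 := by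
  have h : intertwiners ρ ρ ≤ ℂ ∙ (1 : Matrix (Fin n) (Fin n) ℂ) := by
    intro X hX
    obtain ⟨c, rfl⟩ := hρ.exists_eq_smul_one hX
    exact Submodule.smul_mem _ _ (Submodule.mem_span_singleton_self _)
  exact (Submodule.finrank_mono h).trans (finrank_span_le_card _ |>.trans (by simp))

theorem IsIrreducible.titsForm_eq_one {ρ : Rep t s n ℂ} (hρ : IsIrreducible ρ) (hs : s ≠ 0)
    (ht : ∀ i, t i ≠ 0) (hq : ∀ k : ℕ, 0 < k → (s ^ 2) ^ k ≠ 1) : titsForm ρ = 1 := by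
  have h1 := one_le_titsForm ht hq (by simpa using hρ.1) ρ
  have h2 := titsForm_le_finrank_intertwiners hs ht ρ
  have h3 := hρ.finrank_intertwiners_le
  omega

theorem kerDim_add_shiftRank (ρ : Rep t s n ℂ) (i : DAHAGen) :
    kerDim ρ i + shiftRank ρ i = n := by
  have h := (Matrix.toLin' (ρ (gen t s i) - algebraMap ℂ _ (t i))).finrank_range_add_finrank_ker
  have h1 : ρ (shift t s i) = ρ (gen t s i) - algebraMap ℂ _ (t i) := by
    rw [shift, map_sub, AlgHom.commutes]
  rw [kerDim, shiftRank, Matrix.rank, h1, add_comm]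
  rwa [Module.finrank_fintype_fun_eq_card, Fintype.card_fin] at h

theorem moduliDim_eq (ρ : Rep t s n ℂ) : moduliDim ρ = 2 * (1 - titsForm ρ) := by
  have h : ∀ i, (kerDim ρ i : ℤ) = n - shiftRank ρ i := fun i => by
    have := kerDim_add_shiftRank ρ i
    omega
  rw [moduliDim, titsForm, DAHAGen.sum_eq, DAHAGen.sum_eq, Fintype.card_fin]
  simp only [h]
  ring

/-- A nonzero intertwiner from an irreducible representation is invertible. -/
theorem IsIrreducible.isUnit_of_mul_eq_left {ρ ρ' : Rep t s n ℂ} (hρ : IsIrreducible ρ)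
    {X : Matrix (Fin n) (Fin n) ℂ} (hX : ∀ h, ρ' h * X = X * ρ h) (h0 : X ≠ 0) : IsUnit X := by
  rcases hρ.2 (LinearMap.ker X.mulVecLin) (by
    intro h w hw
    rw [LinearMap.mem_ker, Matrix.mulVecLin_apply] at hw ⊢
    rw [Matrix.mulVec_mulVec, ← hX, ← Matrix.mulVec_mulVec, hw, Matrix.mulVec_zero]) with h | h
  · rw [← Matrix.mulVec_injective_iff_isUnit]
    exact LinearMap.ker_eq_bot.1 h
  · refine absurd (Matrix.toLin'.injective ?_) h0
    rw [map_zero]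
    exact LinearMap.ker_eq_top.1 h

/-- A nonzero intertwiner to an irreducible representation is invertible. -/
theorem IsIrreducible.isUnit_of_mul_eq_right {ρ ρ' : Rep t s n ℂ} (hρ : IsIrreducible ρ)
    {X : Matrix (Fin n) (Fin n) ℂ} (hX : ∀ h, ρ h * X = X * ρ' h) (h0 : X ≠ 0) : IsUnit X := by
  rcases hρ.2 (LinearMap.range X.mulVecLin) (by
    rintro h _ ⟨v, rfl⟩
    refine ⟨(ρ' h).mulVec v, ?_⟩
    simp only [Matrix.mulVecLin_apply, Matrix.mulVec_mulVec, hX]) with h | h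
  · refine absurd (Matrix.toLin'.injective ?_) h0
    rw [map_zero]
    exact LinearMap.range_eq_bot.1 h
  · rw [← Matrix.mulVec_surjective_iff_isUnit]
    exact LinearMap.range_eq_top.1 h

theorem equivalent_of_intertwiner {ρ ρ' : Rep t s n ℂ} {X : Matrix (Fin n) (Fin n) ℂ}
    (hX : ∀ h, ρ' h * X = X * ρ h) (hu : IsUnit X) : Equivalent ρ' ρ := by
  obtain ⟨g, rfl⟩ := hu
  exact ⟨g, fun h => by rw [← hX, mul_assoc, Units.mul_inv, mul_one]⟩

end Irreducible

end DAHA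

namespace Matrix

/-! ### Semicontinuity of rank and clearing of denominators. -/

section RankVariation

variable {m : Type*} [Fintype m]

/-- The nonvanishing of the determinant of `P B Q` is an open condition on `B`. -/
theorem eventually_rank_le (A : Matrix m m ℂ) : ∀ᶠ B in 𝓝 A, A.rank ≤ B.rank := by
  obtain ⟨P, Q, hPQ⟩ := exists_mul_mul_eq_one A
  have hc : Continuous fun B : Matrix m m ℂ => (P * B * Q).det :=
    ((continuous_const.matrix_mul continuous_id).matrix_mul continuous_const).matrix_det
  have h : ∀ᶠ B in 𝓝 A, (P * B * Q).det ≠ 0 :=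
    hc.continuousAt.eventually_ne (by simp [hPQ])
  filter_upwards [h] with B hB
  simpa using card_le_rank_of_det_ne_zero B P Q hB

theorem rank_map_le {K L : Type*} [Field K] [Field L] (f : K →+* L) (A : Matrix m m K) :
    (A.map f).rank ≤ A.rank := by
  obtain ⟨B, C, -, -, h, -, -⟩ := exists_rank_factorization A rfl
  calc (A.map f).rank = (B.map f * C.map f).rank := by rw [← Matrix.map_mul, ← h]
    _ ≤ (B.map f).rank := rank_mul_le_left _ _
    _ ≤ A.rank := (rank_le_card_width _).trans (by simp)

/-- The rank at the special point is at most the rank at the generic point. -/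
theorem rank_map_le_rank_map {k R L : Type*} [Field k] [CommRing R] [Field L] [Algebra k R]
    (ev : R →+* k) (hev : ∀ c, ev (algebraMap k R c) = c) (f : R →+* L)
    (hf : Function.Injective f) (A : Matrix m m R) : (A.map ev).rank ≤ (A.map f).rank := by
  obtain ⟨P, Q, hPQ⟩ := exists_mul_mul_eq_one (A.map ev)
  have h : (P.map (algebraMap k R) * A * Q.map (algebraMap k R)).det ≠ 0 := by
    intro h0
    have h1 := congrArg ev h0
    rw [RingHom.map_det, RingHom.mapMatrix_apply, Matrix.map_mul, Matrix.map_mul] at h1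
    have e1 : (P.map (algebraMap k R)).map ev = P := by ext i j; simp [hev]
    have e2 : (Q.map (algebraMap k R)).map ev = Q := by ext i j; simp [hev]
    rw [e1, e2, hPQ, det_one, map_zero] at h1
    exact one_ne_zero h1
  have h2 := card_le_rank_of_det_ne_zero (A.map f) ((P.map (algebraMap k R)).map f)
    ((Q.map (algebraMap k R)).map f) (by
      have h3 := (map_ne_zero_iff f hf).2 h
      rwa [RingHom.map_det, RingHom.mapMatrix_apply, Matrix.map_mul, Matrix.map_mul] at h3)
  simpa using h2

theorem two_mul_rank_le_rank_fromBlocks {K : Type*} [Field K] (N U : Matrix m m K) :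
    2 * N.rank ≤ (fromBlocks N 0 U N).rank := by
  obtain ⟨P, Q, hPQ⟩ := exists_mul_mul_eq_one N
  have h := card_le_rank_of_det_ne_zero (fromBlocks N 0 U N) (fromBlocks P 0 0 P)
    (fromBlocks Q 0 0 Q) (by simp [fromBlocks_multiply, hPQ])
  simp only [Fintype.card_sum, Fintype.card_fin] at h
  omega

theorem rank_fromBlocks_le_two_mul {K : Type*} [Field K] (N : Matrix m m K) :
    (fromBlocks N 0 0 N).rank ≤ 2 * N.rank := by
  obtain ⟨B, C, -, -, h, -, -⟩ := exists_rank_factorization N rfl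
  have h1 : fromBlocks N 0 0 N = fromBlocks B 0 0 B * fromBlocks C 0 0 C := by
    simp [fromBlocks_multiply, ← h]
  rw [h1]
  refine (rank_mul_le_left _ _).trans ((rank_le_card_width _).trans ?_)
  simp only [Fintype.card_sum, Fintype.card_fin]
  omega

/-- The exponent is the least order of vanishing among the entries. -/
theorem exists_eq_X_pow_smul {k m m' : Type*} [Field k] {Y : Matrix m m' (PowerSeries k)}
    (hY : Y ≠ 0) : ∃ (d : ℕ) (Z : Matrix m m' (PowerSeries k)),
      Y = (PowerSeries.X ^ d : PowerSeries k) • Z ∧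
        Z.map (PowerSeries.constantCoeff (R := k)) ≠ 0 := by
  classical
  have hex : ∃ d, ∃ i j, PowerSeries.coeff d (Y i j) ≠ 0 := by
    by_contra! h
    exact hY (Matrix.ext fun i j => PowerSeries.ext fun d => by simpa using h d i j)
  obtain ⟨i, j, hij⟩ := Nat.find_spec hex
  have hdvd : ∀ a b, (PowerSeries.X ^ Nat.find hex : PowerSeries k) ∣ Y a b := by
    intro a b
    rw [PowerSeries.X_pow_dvd_iff]
    intro e he
    have := Nat.find_min hex he
    push Not at this
    exact this a b
  choose Z hZ using hdvd
  refine ⟨Nat.find hex, Matrix.of Z, Matrix.ext hZ, fun h => hij ?_⟩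
  have h1 : PowerSeries.constantCoeff (Z i j) = 0 := congrFun (congrFun h i) j
  have h2 := PowerSeries.coeff_X_pow_mul (Z i j) (Nat.find hex) 0
  rw [← hZ, zero_add] at h2
  rw [h2, PowerSeries.coeff_zero_eq_constantCoeff_apply, h1]

/-- Clearing denominators. -/
theorem exists_map_algebraMap_eq_smul {R K m' : Type*} [Fintype m'] [CommRing R] [IsDomain R]
    [Field K] [Algebra R K] [IsFractionRing R K] (X : Matrix m m' K) :
    ∃ (d : R) (Y : Matrix m m' R), d ≠ 0 ∧ Y.map (algebraMap R K) = algebraMap R K d • X := by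
  obtain ⟨b, hb⟩ := IsLocalization.exist_integer_multiples_of_finite (nonZeroDivisors R)
    (fun p : m × m' => X p.1 p.2)
  choose Y hY using hb
  refine ⟨b, Matrix.of fun i j => Y (i, j), nonZeroDivisors.coe_ne_zero b, ?_⟩
  ext i j
  have := hY (i, j)
  simpa [Algebra.smul_def] using this

end RankVariation

end Matrix

namespace DAHA

variable {t : DAHAGen → ℂ} {s : ℂ} {n : ℕ}

section RankVariation

variable {K : Type*} [Field K] [Algebra ℂ K] {m m' : Type*} [Fintype m] [Fintype m']
  [DecidableEq m] [DecidableEq m']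

/-- For simple roots the ranks of `N` and `N - c` sum to the full dimension, so if one does not
drop, the other does not grow. -/
theorem shiftRank_le_of_le_rank_sub (ρ ρ' : DAHA t s →ₐ[ℂ] Matrix m m K) {i : DAHAGen}
    (hi : shiftRoot t i ≠ 0)
    (h : (ρ (shift t s i - algebraMap ℂ _ (shiftRoot t i))).rank ≤
      (ρ' (shift t s i - algebraMap ℂ _ (shiftRoot t i))).rank) :
    shiftRank ρ' i ≤ shiftRank ρ i := by
  have e : ∀ σ : DAHA t s →ₐ[ℂ] Matrix m m K, σ (shift t s i - algebraMap ℂ _ (shiftRoot t i)) =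
      σ (shift t s i) - algebraMap ℂ K (shiftRoot t i) • 1 := by
    intro σ
    rw [map_sub, AlgHom.commutes, Algebra.algebraMap_eq_smul_one, algebraMap_smul]
  rw [e, e] at h
  have h1 := Matrix.rank_add_rank_le_card_of_mul_eq_zero (map_shift_mul_sub ρ' i)
  have h2 := Matrix.card_le_rank_add_rank_sub (ρ (shift t s i))
    (c := algebraMap ℂ K (shiftRoot t i)) (by simpa using hi)
  rw [shiftRank, shiftRank]
  omega

end RankVariation

theorem eventually_rank_map_gen_sub_le (ρ : Rep t s n ℂ) (c : DAHAGen → ℂ) :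
    ∀ᶠ f : DAHAGen → Matrix (Fin n) (Fin n) ℂ in 𝓝 (fun i => ρ (gen t s i)),
      ∀ i, (ρ (gen t s i) - c i • 1).rank ≤ (f i - c i • 1).rank := by
  rw [Filter.eventually_all]
  intro i
  have hc : Continuous fun f : DAHAGen → Matrix (Fin n) (Fin n) ℂ =>
      f i - c i • (1 : Matrix (Fin n) (Fin n) ℂ) :=
    (continuous_apply i).sub continuous_const
  exact (hc.tendsto fun i => ρ (gen t s i)).eventually
    (Matrix.eventually_rank_le (ρ (gen t s i) - c i • 1))

theorem IsIrreducible.locallyRigid {ρ : Rep t s n ℂ} (hρ : IsIrreducible ρ) (hs : s ≠ 0)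
    (ht : ∀ i, t i ≠ 0) (hq : ∀ k : ℕ, 0 < k → (s ^ 2) ^ k ≠ 1) : LocallyRigid ρ := by
  -- The neighbourhood is where the ranks of `T` minus each of its two roots do not drop; `t i +
  -- shiftRoot t i` is the other root `-(t i)⁻¹`.
  refine ⟨_, (eventually_rank_map_gen_sub_le ρ t).and
    (eventually_rank_map_gen_sub_le ρ fun i => t i + shiftRoot t i), fun ρ' hρ' => ?_⟩
  obtain ⟨h1, h2⟩ := hρ'
  have e1 : ∀ (σ : Rep t s n ℂ) i, σ (shift t s i) = σ (gen t s i) - t i • 1 := by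
    intro σ i
    rw [shift, map_sub, AlgHom.commutes, Algebra.algebraMap_eq_smul_one]
  have e2 : ∀ (σ : Rep t s n ℂ) i, σ (shift t s i - algebraMap ℂ _ (shiftRoot t i)) =
      σ (gen t s i) - (t i + shiftRoot t i) • 1 := by
    intro σ i
    rw [map_sub, e1, AlgHom.commutes, Algebra.algebraMap_eq_smul_one, add_smul, sub_sub]
  rcases exists_ne_zero_intertwiner hs ht hq (by simpa using hρ.1) ρ ρ'
    (fun i => by rw [shiftRank, shiftRank, e1, e1]; exact h1 i)
    (fun i hi => shiftRank_le_of_le_rank_sub ρ ρ' hi (by rw [e2, e2]; exact h2 i))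
    with ⟨X, hX, h0⟩ | ⟨X, hX, h0⟩
  · exact equivalent_of_intertwiner hX (hρ.isUnit_of_mul_eq_left hX h0)
  · obtain ⟨g, rfl⟩ := hρ.isUnit_of_mul_eq_right hX h0
    refine equivalent_of_intertwiner (X := (g⁻¹ : (Matrix (Fin n) (Fin n) ℂ)ˣ)) (fun h => ?_)
      (Units.isUnit _)
    rw [Units.eq_inv_mul_iff_mul_eq, ← mul_assoc, Units.mul_inv_eq_iff_eq_mul]
    exact (hX h).symm

/-! ### From intertwiners to trivial deformations. -/

section Trivial

variable {R : Type} [CommRing R] [Algebra ℂ R]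

/-- Dividing by `c` normalizes the intertwiner to the identity at the base point; its determinant is
then a unit, as units are detected there. -/
theorem isTrivialDeformation_of_mul_eq_left {ev : R →+* ℂ}
    (hev : ∀ c, ev (algebraMap ℂ R c) = c) (hloc : ∀ a, IsUnit (ev a) → IsUnit a)
    {ρ : Rep t s n ℂ} {ρ' : Rep t s n R} {Z : Matrix (Fin n) (Fin n) R} {c : ℂ} (hc : c ≠ 0)
    (hZ : Z.map ev = c • 1) (h : ∀ x, ρ' x * Z = Z * (ρ x).map (algebraMap ℂ R)) :
    IsTrivialDeformation ev ρ ρ' := by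
  have hZ' : (algebraMap ℂ R c⁻¹ • Z).map ev = 1 := by
    have : (algebraMap ℂ R c⁻¹ • Z).map ev = c⁻¹ • Z.map ev := by
      ext i j
      simp only [Matrix.map_apply, Matrix.smul_apply, smul_eq_mul, map_mul, hev]
    rw [this, hZ, smul_smul, inv_mul_cancel₀ hc, one_smul]
  have hu : IsUnit (algebraMap ℂ R c⁻¹ • Z) := by
    rw [Matrix.isUnit_iff_isUnit_det]
    apply hloc
    rw [RingHom.map_det, RingHom.mapMatrix_apply, hZ', Matrix.det_one]
    exact isUnit_one
  obtain ⟨g, hg⟩ := hu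
  refine ⟨g, by rw [hg, hZ'], fun x => ?_⟩
  have hx : ρ' x * g = g * (ρ x).map (algebraMap ℂ R) := by
    rw [hg, Matrix.mul_smul, Matrix.smul_mul, h]
  rw [← hx, mul_assoc, Units.mul_inv, mul_one]

theorem isTrivialDeformation_of_mul_eq_right {ev : R →+* ℂ}
    (hev : ∀ c, ev (algebraMap ℂ R c) = c) (hloc : ∀ a, IsUnit (ev a) → IsUnit a)
    {ρ : Rep t s n ℂ} {ρ' : Rep t s n R} {Z : Matrix (Fin n) (Fin n) R} {c : ℂ} (hc : c ≠ 0)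
    (hZ : Z.map ev = c • 1) (h : ∀ x, (ρ x).map (algebraMap ℂ R) * Z = Z * ρ' x) :
    IsTrivialDeformation ev ρ ρ' := by
  have hu : IsUnit Z := by
    rw [Matrix.isUnit_iff_isUnit_det]
    apply hloc
    rw [RingHom.map_det, RingHom.mapMatrix_apply, hZ, Matrix.det_smul, Matrix.det_one, mul_one]
    exact (isUnit_iff_ne_zero.2 hc).pow _
  obtain ⟨g, rfl⟩ := hu
  refine isTrivialDeformation_of_mul_eq_left hev hloc (inv_ne_zero hc)
    (Z := (g⁻¹ : (Matrix (Fin n) (Fin n) R)ˣ)) ?_ fun x => ?_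
  · have h1 : (g : Matrix (Fin n) (Fin n) R).map ev *
        ((g⁻¹ : (Matrix (Fin n) (Fin n) R)ˣ) : Matrix (Fin n) (Fin n) R).map ev = 1 := by
      rw [← Matrix.map_mul, Units.mul_inv]
      exact Matrix.map_one _ (map_zero _) (map_one _)
    rw [hZ, Matrix.smul_mul, Matrix.one_mul] at h1
    rw [← h1, smul_smul, inv_mul_cancel₀ hc, one_smul]
  · rw [Units.eq_inv_mul_iff_mul_eq, ← mul_assoc, Units.mul_inv_eq_iff_eq_mul]
    exact (h x).symm

end Trivial

/-! ### Formal deformations. -/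

section Formal

open PowerSeries

/-- Scalar extension of a representation. -/
noncomputable def baseChange {R L : Type*} [CommRing R] [CommRing L] [Algebra ℂ R] [Algebra ℂ L]
    {m : Type*} [Fintype m] [DecidableEq m] (f : R →ₐ[ℂ] L) (ρ : DAHA t s →ₐ[ℂ] Matrix m m R) :
    DAHA t s →ₐ[ℂ] Matrix m m L :=
  f.mapMatrix.comp ρ

/-- Clearing denominators and dividing by the largest common power of `x` keeps the intertwining
property and makes the constant term nonzero. -/
theorem exists_powerSeries_intertwiner {A B : DAHA t s → Matrix (Fin n) (Fin n) ℂ⟦X⟧}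
    {X : Matrix (Fin n) (Fin n) (FractionRing ℂ⟦X⟧)} (h0 : X ≠ 0)
    (hX : ∀ x, (A x).map (algebraMap ℂ⟦X⟧ (FractionRing ℂ⟦X⟧)) * X =
      X * (B x).map (algebraMap ℂ⟦X⟧ (FractionRing ℂ⟦X⟧))) :
    ∃ Z : Matrix (Fin n) (Fin n) ℂ⟦X⟧, Z.map (constantCoeff (R := ℂ)) ≠ 0 ∧
      ∀ x, A x * Z = Z * B x := by
  have hinj := IsFractionRing.injective ℂ⟦X⟧ (FractionRing ℂ⟦X⟧)
  obtain ⟨d, Y, hd, hY⟩ := Matrix.exists_map_algebraMap_eq_smul (R := ℂ⟦X⟧) X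
  have hY0 : Y ≠ 0 := by
    rintro rfl
    rw [Matrix.map_zero _ (map_zero _), eq_comm, smul_eq_zero] at hY
    exact hY.elim (fun h => hd ((map_eq_zero_iff _ hinj).1 h)) h0
  obtain ⟨k, Z, rfl, hZ⟩ := Matrix.exists_eq_X_pow_smul hY0
  refine ⟨Z, hZ, fun x => ?_⟩
  have h1 : A x * ((PowerSeries.X ^ k : ℂ⟦X⟧) • Z) = ((PowerSeries.X ^ k : ℂ⟦X⟧) • Z) * B x := by
    apply Matrix.map_injective hinj
    simp only [Matrix.map_mul, hY]
    rw [Matrix.mul_smul, Matrix.smul_mul, hX]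
  rw [Matrix.mul_smul, Matrix.smul_mul] at h1
  exact smul_right_injective _ (pow_ne_zero k PowerSeries.X_ne_zero) h1

theorem IsIrreducible.formallyRigid {ρ : Rep t s n ℂ} (hρ : IsIrreducible ρ) (hs : s ≠ 0)
    (ht : ∀ i, t i ≠ 0) (hq : ∀ k : ℕ, 0 < k → (s ^ 2) ^ k ≠ 1) : FormallyRigid ρ := by
  intro ρ' hdef
  have hev : ∀ c, constantCoeff (R := ℂ) (algebraMap ℂ ℂ⟦X⟧ c) = c := by
    intro c
    simp
  have hloc : ∀ a : ℂ⟦X⟧, IsUnit (constantCoeff (R := ℂ) a) → IsUnit a := fun a ha =>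
    PowerSeries.isUnit_iff_constantCoeff.2 ha
  let K := FractionRing ℂ⟦X⟧
  let ρK : DAHA t s →ₐ[ℂ] Matrix (Fin n) (Fin n) K := baseChange (Algebra.ofId ℂ K) ρ
  let ρK' : DAHA t s →ₐ[ℂ] Matrix (Fin n) (Fin n) K :=
    baseChange (IsScalarTower.toAlgHom ℂ ℂ⟦X⟧ K) ρ'
  have hinj := IsFractionRing.injective ℂ⟦X⟧ K
  -- The rank at the generic point is at least that at the closed point. This holds for all elements
  -- of `H`, hence for both roots of each generator.
  have hrank : ∀ x, (ρK x).rank ≤ (ρK' x).rank := by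
    intro x
    calc (ρK x).rank ≤ (ρ x).rank := Matrix.rank_map_le (algebraMap ℂ K) (ρ x)
      _ ≤ (ρK' x).rank := by
        rw [← hdef x]
        exact Matrix.rank_map_le_rank_map _ hev (algebraMap ℂ⟦X⟧ K) hinj (ρ' x)
  have hρK : ∀ x, ρK x = ((ρ x).map (algebraMap ℂ ℂ⟦X⟧)).map (algebraMap ℂ⟦X⟧ K) := by
    intro x
    ext i j
    exact IsScalarTower.algebraMap_apply ℂ ℂ⟦X⟧ K _
  have hscalar : ∀ Z : Matrix (Fin n) (Fin n) ℂ⟦X⟧, Z.map (constantCoeff (R := ℂ)) ≠ 0 →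
      (∀ x, ρ x * Z.map (constantCoeff (R := ℂ)) = Z.map (constantCoeff (R := ℂ)) * ρ x) →
      ∃ c : ℂ, c ≠ 0 ∧ Z.map (constantCoeff (R := ℂ)) = c • 1 := by
    intro Z hZ h
    obtain ⟨c, hc⟩ := hρ.exists_eq_smul_one h
    refine ⟨c, ?_, hc⟩
    rintro rfl
    exact hZ (by rw [hc, zero_smul])
  have hconst : ∀ x, ((ρ x).map (algebraMap ℂ ℂ⟦X⟧)).map (constantCoeff (R := ℂ)) = ρ x := by
    intro x
    ext i j
    exact hev _
  rcases exists_ne_zero_intertwiner hs ht hq (by simpa using hρ.1) ρK ρK'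
    (fun i => hrank _) (fun i hi => shiftRank_le_of_le_rank_sub ρK ρK' hi (hrank _)) with ⟨X, hX, h0⟩ | ⟨X, hX, h0⟩
  · obtain ⟨Z, hZ, hcomm⟩ := exists_powerSeries_intertwiner (A := fun x => ρ' x)
      (B := fun x => (ρ x).map (algebraMap ℂ ℂ⟦X⟧)) h0 (fun x => by
        rw [← hρK]; exact hX x)
    obtain ⟨c, hc, hZc⟩ := hscalar Z hZ (fun x => by
      have := congrArg (fun M => M.map (constantCoeff (R := ℂ))) (hcomm x)
      simpa only [Matrix.map_mul, hdef x, hconst] using this)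
    exact isTrivialDeformation_of_mul_eq_left hev hloc hc hZc hcomm
  · obtain ⟨Z, hZ, hcomm⟩ := exists_powerSeries_intertwiner (B := fun x => ρ' x)
      (A := fun x => (ρ x).map (algebraMap ℂ ℂ⟦X⟧)) h0 (fun x => by
        rw [← hρK]; exact hX x)
    obtain ⟨c, hc, hZc⟩ := hscalar Z hZ (fun x => by
      have := congrArg (fun M => M.map (constantCoeff (R := ℂ))) (hcomm x)
      simpa only [Matrix.map_mul, hdef x, hconst] using this)
    exact isTrivialDeformation_of_mul_eq_right hev hloc hc hZc hcomm

end Formal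

end DAHA

namespace DAHA

variable {t : DAHAGen → ℂ} {s : ℂ} {n : ℕ}

/-! ### First-order deformations. -/

section Infinitesimal

open TrivSqZeroExt Matrix

/-- A matrix over the dual numbers, as a block matrix over `ℂ`. -/
noncomputable def dualBlocks (n : ℕ) : Matrix (Fin n) (Fin n) (DualNumber ℂ) →ₐ[ℂ]
    Matrix (Fin n ⊕ Fin n) (Fin n ⊕ Fin n) ℂ :=
  AlgHom.ofLinearMap
    { toFun := fun A => fromBlocks (A.map fst) 0 (A.map snd) (A.map fst)
      map_add' := fun A B => by
        rw [fromBlocks_add]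
        congr 1
        simp
      map_smul' := fun c A => by
        rw [RingHom.id_apply, fromBlocks_smul]
        congr 1
        simp }
    (by
      change fromBlocks _ _ _ _ = 1
      rw [← fromBlocks_one]
      congr 1
      all_goals
        ext i j
        by_cases h : i = j <;> simp [Matrix.one_apply, h])
    (fun A B => by
      change fromBlocks _ _ _ _ = fromBlocks _ _ _ _ * fromBlocks _ _ _ _
      rw [fromBlocks_multiply]
      congr 1
      · ext i j
        simp [Matrix.mul_apply, fst_sum]
      · simp
      · ext i j
        simp [Matrix.mul_apply, snd_sum, Finset.sum_add_distrib, add_comm, mul_comm]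
      · ext i j
        simp [Matrix.mul_apply, fst_sum])

theorem dualBlocks_apply (A : Matrix (Fin n) (Fin n) (DualNumber ℂ)) :
    dualBlocks n A = fromBlocks (A.map fst) 0 (A.map snd) (A.map fst) := rfl

theorem dualBlocks_map_algebraMap (A : Matrix (Fin n) (Fin n) ℂ) :
    dualBlocks n (A.map (algebraMap ℂ (DualNumber ℂ))) = fromBlocks A 0 0 A := by
  rw [dualBlocks_apply]
  congr 1

/-- The underlying complex representation of a representation over the dual numbers. -/
noncomputable def dualRep (ρ' : Rep t s n (DualNumber ℂ)) :
    DAHA t s →ₐ[ℂ] Matrix (Fin n ⊕ Fin n) (Fin n ⊕ Fin n) ℂ :=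
  (dualBlocks n).comp ρ'

theorem dualRep_apply {ρ : Rep t s n ℂ} {ρ' : Rep t s n (DualNumber ℂ)}
    (hdef : IsDeformation (fstHom ℂ ℂ ℂ : DualNumber ℂ →ₐ[ℂ] ℂ).toRingHom ρ ρ') (x : DAHA t s) :
    dualRep ρ' x = fromBlocks (ρ x) 0 ((ρ' x).map snd) (ρ x) := by
  have h : (ρ' x).map fst = ρ x := hdef x
  change dualBlocks n (ρ' x) = _
  rw [dualBlocks_apply, h]

/-- The rank in a self-extension is at least `2r`. For simple roots the same bound for the
complementary factor forces equality; at a double root equality comes from conjugacy to the constant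
deformation. -/
theorem shiftRank_dualRep {ρ : Rep t s n ℂ} {ρ' : Rep t s n (DualNumber ℂ)}
    (hdef : IsDeformation (fstHom ℂ ℂ ℂ : DualNumber ℂ →ₐ[ℂ] ℂ).toRingHom ρ ρ') (i : DAHAGen)
    (hcl : shiftRoot t i = 0 →
      PreservesClass (fstHom ℂ ℂ ℂ : DualNumber ℂ →ₐ[ℂ] ℂ).toRingHom ρ ρ' i) :
    shiftRank (dualRep ρ') i = 2 * shiftRank ρ i := by
  have hle : ∀ x, 2 * (ρ x).rank ≤ (dualRep ρ' x).rank := fun x => by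
    rw [dualRep_apply hdef]
    exact two_mul_rank_le_rank_fromBlocks _ _
  refine le_antisymm ?_ (hle _)
  by_cases hi : shiftRoot t i = 0
  · obtain ⟨g, -, hg⟩ := hcl hi
    have h1 : ρ' (shift t s i) = (g : Matrix (Fin n) (Fin n) (DualNumber ℂ)) *
        (ρ (shift t s i)).map (algebraMap ℂ (DualNumber ℂ)) *
        ((g⁻¹ : GL (Fin n) (DualNumber ℂ)) : Matrix _ _ (DualNumber ℂ)) := by
      have h2 : (ρ (shift t s i)).map (algebraMap ℂ (DualNumber ℂ)) =
          (ρ (gen t s i)).map (algebraMap ℂ (DualNumber ℂ)) - algebraMap ℂ _ (t i) := by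
        change (Algebra.ofId ℂ (DualNumber ℂ)).mapMatrix (ρ (shift t s i)) = _
        rw [shift, map_sub, map_sub, AlgHom.commutes, AlgHom.commutes]
        rfl
      rw [h2, mul_sub, sub_mul, ← hg, ← Algebra.commutes, mul_assoc, Units.mul_inv, mul_one, shift,
        map_sub, AlgHom.commutes]
    have h3 : dualRep ρ' (shift t s i) = dualBlocks n g *
        fromBlocks (ρ (shift t s i)) 0 0 (ρ (shift t s i)) *
          dualBlocks n ((g⁻¹ : GL (Fin n) (DualNumber ℂ)) : Matrix _ _ (DualNumber ℂ)) := by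
      change dualBlocks n (ρ' (shift t s i)) = _
      rw [h1, map_mul, map_mul, dualBlocks_map_algebraMap]
    rw [shiftRank, h3]
    exact (rank_mul_le_left _ _).trans ((rank_mul_le_right _ _).trans
      (rank_fromBlocks_le_two_mul _))
  · have h1 := rank_add_rank_le_card_of_mul_eq_zero (map_shift_mul_sub (dualRep ρ') i)
    have h2 := card_le_rank_add_rank_sub (ρ (shift t s i)) hi
    have h3 := hle (shift t s i - algebraMap ℂ _ (shiftRoot t i))
    simp only [map_sub, AlgHom.commutes] at h3
    simp only [Algebra.algebraMap_eq_smul_one] at h3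
    simp only [Algebra.algebraMap_self, RingHom.id_apply, Fintype.card_sum, Fintype.card_fin]
      at h1 h2
    rw [shiftRank, shiftRank]
    omega

theorem IsIrreducible.infinitesimallyRigid {ρ : Rep t s n ℂ} (hρ : IsIrreducible ρ) (hs : s ≠ 0)
    (ht : ∀ i, t i ≠ 0) (hq : ∀ k : ℕ, 0 < k → (s ^ 2) ^ k ≠ 1) : InfinitesimallyRigid ρ := by
  intro ρ' hdef hcl
  have hcl' : ∀ i, shiftRoot t i = 0 →
      PreservesClass (fstHom ℂ ℂ ℂ : DualNumber ℂ →ₐ[ℂ] ℂ).toRingHom ρ ρ' i := by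
    intro i hi
    refine hcl i ?_
    have h1 : t i * shiftRoot t i = -(t i ^ 2 + 1) := by
      rw [shiftRoot]
      field_simp [ht i]
    rw [hi, mul_zero] at h1
    linear_combination h1
  have hev : ∀ c, (fstHom ℂ ℂ ℂ : DualNumber ℂ →ₐ[ℂ] ℂ).toRingHom
      (algebraMap ℂ (DualNumber ℂ) c) = c := fun c => rfl
  have hloc : ∀ a : DualNumber ℂ, IsUnit ((fstHom ℂ ℂ ℂ : DualNumber ℂ →ₐ[ℂ] ℂ).toRingHom a) →
      IsUnit a := fun a ha => isUnit_iff_isUnit_fst.2 ha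
  -- All data of `dualRep ρ'` are twice those of `ρ`, so the Euler form is `2 · 2 titsForm ρ = 4`,
  -- and one of the two spaces has dimension at least `2`.
  have hdim : 4 ≤ Module.finrank ℂ (intertwiners ρ (dualRep ρ')) +
      Module.finrank ℂ (intertwiners (dualRep ρ') ρ) := by
    have h1 := two_mul_card_mul_card_le hs ht ρ (dualRep ρ')
    have h2 := hρ.titsForm_eq_one hs ht hq
    rw [titsForm, DAHAGen.sum_eq] at h2
    rw [DAHAGen.sum_eq] at h1
    simp only [shiftRank_dualRep hdef _ (hcl' _), Fintype.card_sum, Fintype.card_fin] at h1 h2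
    push_cast at h1 h2
    zify
    linarith
  have hfst : ∀ x i j, (ρ' x i j).fst = ρ x i j := fun x i j => congrFun (congrFun (hdef x) i) j
  by_cases hA : 2 ≤ Module.finrank ℂ (intertwiners ρ (dualRep ρ'))
  · have hmem : ∀ X ∈ intertwiners ρ (dualRep ρ'), ∀ x, ρ x * X.toRows₁ = X.toRows₁ * ρ x ∧
        (ρ' x).map snd * X.toRows₁ + ρ x * X.toRows₂ = X.toRows₂ * ρ x := by
      intro X hX x
      have h1 := hX x
      rw [← fromRows_toRows X, dualRep_apply hdef, fromBlocks_mul_fromRows, fromRows_mul] at h1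
      obtain ⟨h2, h3⟩ := fromRows_inj h1
      exact ⟨by simpa using h2, h3⟩
    -- If all upper blocks vanished, every intertwiner would land in the subrepresentation `ε ℂⁿ ≅
    -- ρ`, leaving at most `dim End ρ ≤ 1` dimensions.
    obtain ⟨X, hX, hX1⟩ : ∃ X ∈ intertwiners ρ (dualRep ρ'), X.toRows₁ ≠ 0 := by
      by_contra! hcon
      let f : intertwiners ρ (dualRep ρ') →ₗ[ℂ] intertwiners ρ ρ :=
        { toFun := fun X => ⟨X.1.toRows₂, fun x => by
            have := (hmem X.1 X.2 x).2
            rwa [hcon X.1 X.2, Matrix.mul_zero, zero_add] at this⟩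
          map_add' := fun X Y => rfl
          map_smul' := fun c X => rfl }
      have hf : Function.Injective f := by
        intro X Y hXY
        refine Subtype.ext ?_
        rw [← fromRows_toRows X.1, ← fromRows_toRows Y.1, hcon X.1 X.2, hcon Y.1 Y.2]
        exact congrArg (fun M => fromRows 0 M) (congrArg Subtype.val hXY)
      have := LinearMap.finrank_le_finrank_of_injective hf
      have := hρ.finrank_intertwiners_le
      omega
    obtain ⟨c, hc⟩ := hρ.exists_eq_smul_one fun x => (hmem X hX x).1
    have hc0 : c ≠ 0 := by
      rintro rfl
      exact hX1 (by rw [hc, zero_smul])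
    -- The two block equations say precisely that `X₁ + ε X₂` intertwines over `ℂ[ε]`.
    refine isTrivialDeformation_of_mul_eq_left hev hloc hc0
      (Z := Matrix.of fun i j => inl (X.toRows₁ i j) + inr (X.toRows₂ i j)) ?_ fun x => ?_
    · rw [← hc]
      ext i j
      simp
    · ext i j
      · have := congrFun (congrFun (hmem X hX x).1 i) j
        simpa [Matrix.mul_apply, fst_sum, hfst, algebraMap_eq_inl] using this
      · have := congrFun (congrFun (hmem X hX x).2 i) j
        simp only [Matrix.mul_apply, Matrix.add_apply, Matrix.map_apply] at this
        simp [Matrix.mul_apply, snd_sum, hfst, algebraMap_eq_inl, Finset.sum_add_distrib]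
        rw [add_comm]
        exact this
  · have hmem : ∀ X ∈ intertwiners (dualRep ρ') ρ, ∀ x, ρ x * X.toCols₂ = X.toCols₂ * ρ x ∧
        ρ x * X.toCols₁ = X.toCols₁ * ρ x + X.toCols₂ * (ρ' x).map snd := by
      intro X hX x
      have h1 := hX x
      rw [← fromCols_toCols X, dualRep_apply hdef, fromCols_mul_fromBlocks, mul_fromCols] at h1
      obtain ⟨h2, h3⟩ := fromCols_inj h1
      exact ⟨by simpa using h3, h2⟩
    -- Dually, intertwiners vanishing on the subrepresentation factor through the quotient `ρ`. The
    -- restriction `X₂` to the subrepresentation thus becomes the constant term of the intertwiner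
    -- over `ℂ[ε]`.
    obtain ⟨X, hX, hX2⟩ : ∃ X ∈ intertwiners (dualRep ρ') ρ, X.toCols₂ ≠ 0 := by
      by_contra! hcon
      let f : intertwiners (dualRep ρ') ρ →ₗ[ℂ] intertwiners ρ ρ :=
        { toFun := fun X => ⟨X.1.toCols₁, fun x => by
            have := (hmem X.1 X.2 x).2
            rwa [hcon X.1 X.2, Matrix.zero_mul, add_zero] at this⟩
          map_add' := fun X Y => rfl
          map_smul' := fun c X => rfl }
      have hf : Function.Injective f := by
        intro X Y hXY
        refine Subtype.ext ?_
        rw [← fromCols_toCols X.1, ← fromCols_toCols Y.1, hcon X.1 X.2, hcon Y.1 Y.2]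
        exact congrArg (fun M => fromCols M 0) (congrArg Subtype.val hXY)
      have := LinearMap.finrank_le_finrank_of_injective hf
      have := hρ.finrank_intertwiners_le
      omega
    obtain ⟨c, hc⟩ := hρ.exists_eq_smul_one fun x => (hmem X hX x).1
    have hc0 : c ≠ 0 := by
      rintro rfl
      exact hX2 (by rw [hc, zero_smul])
    refine isTrivialDeformation_of_mul_eq_right hev hloc hc0
      (Z := Matrix.of fun i j => inl (X.toCols₂ i j) + inr (X.toCols₁ i j)) ?_ fun x => ?_
    · rw [← hc]
      ext i j
      simp
    · ext i j
      · have := congrFun (congrFun (hmem X hX x).1 i) j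
        simpa [Matrix.mul_apply, fst_sum, hfst, algebraMap_eq_inl] using this
      · have := congrFun (congrFun (hmem X hX x).2 i) j
        simp only [Matrix.mul_apply, Matrix.add_apply, Matrix.map_apply] at this
        simp [Matrix.mul_apply, snd_sum, hfst, algebraMap_eq_inl, Finset.sum_add_distrib]
        exact this.trans (add_comm _ _)

end Infinitesimal

end DAHA

theorem mainTheorem2 (t : DAHAGen → ℂ) (ht : ∀ i, t i ≠ 0) (q s : ℂ) (hs : s ^ 2 = q)
    (hq0 : q ≠ 0) (hq : ∀ m : ℕ, 0 < m → q ^ m ≠ 1) (n : ℕ) (ρ : DAHA.Rep t s n ℂ)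
    (hρ : DAHA.IsIrreducible ρ) :
    DAHA.IsRigid ρ ∧ DAHA.moduliDim ρ = 0 := by
  subst hs
  have hs0 : s ≠ 0 := by
    rintro rfl
    exact hq0 (by simp)
  refine ⟨⟨hρ.formallyRigid hs0 ht hq, hρ.locallyRigid hs0 ht hq,
    hρ.infinitesimallyRigid hs0 ht hq⟩, ?_⟩
  rw [DAHA.moduliDim_eq, hρ.titsForm_eq_one hs0 ht hq, sub_self, mul_zero]
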